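/- Let $d\in\mathbb N$ and $\varphi\colon(0,1]\to[0,d]$. For a non-empty metric space $X$, $x\in X$, $r>0$ and $E\subset X$, let $B(x,r)$ be the closed ball in $X$ and let $N_r(E)$ be the least number of closed balls of radius $r$ needed to cover $E$. For $0<\theta<1$ the monotone lower spectrum of $X$ is $$\underline{\dim}^{\theta}_{\mathrm L}X=\sup\Bigl\{s\ge 0:\exists C>0\ \forall\, 0<r\le r^\theta\le R<1,\ \inf_{x\in X}N_r(B(x,R))\ge C\Bigl(\frac Rr\Bigr)^s\Bigr\},$$ and $(1-\theta)\,\underline{\dim}^{\theta}_{\mathrm L}X$ is understood to be $0$ at $\theta=1$. For $\lambda\in(0,1]$ and $0\le t\le d(1-\lambda)$ let $$\phi_{d,\lambda,t}(\theta)=\begin{cases} d+\frac{\theta}{\lambda}(t-d), & 0<\theta\le\lambda,\\ t\,\frac{1-\theta}{1-\lambda}, & \lambda<\theta\le 1.\end{cases}$$ Then the following are equivalent. 1. There is a non-empty set $F\subset\mathbb R^d$ (with the Euclidean metric) such that $(1-\theta)\,\underline{\dim}^{\theta}_{\mathrm L}F=\varphi(\theta)$ for all $\theta\in(0,1]$.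 2. The function $\theta\mapsto\varphi(\theta)/(1-\theta)$ is decreasing (not necessarily strictly) on $(0,1)$, $\varphi(1)=0$, and $\varphi(\lambda\theta)-\theta\varphi(\lambda)\le(1-\theta)d$ for all $\lambda,\theta\in(0,1]$. 3. $\varphi$ is the pointwise infimum on $(0,1]$ of a non-empty family of functions of the form $\phi_{d,\lambda,t}$ with $\lambda\in(0,1]$ and $0\le t\le d(1-\lambda)$. -/

import Mathlib

open scoped NNReal ENNReal

/-- `N_r(E)`: the least number of closed balls of radius `r`, centred in the metric space `X`,
needed to cover `E ⊆ X` (it is `⊤` if no finite number suffices). -/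
noncomputable def closedBallCoveringNumber {X : Type*} [MetricSpace X] (r : ℝ) (E : Set X) : ℕ∞ :=
  Metric.externalCoveringNumber r.toNNReal E

/-- The exponent `s` is admissible for the monotone lower spectrum of `X` at `θ`: there is `C > 0`
such that `inf_{x ∈ X} N_r(B(x, R)) ≥ C (R / r) ^ s` whenever `0 < r ≤ r ^ θ ≤ R < 1`. -/
def IsMonotoneLowerExponent (X : Type*) [MetricSpace X] (θ : ℝ) (s : ℝ) : Prop :=
  ∃ C : ℝ, 0 < C ∧ ∀ r R : ℝ, 0 < r → r ≤ r ^ θ → r ^ θ ≤ R → R < 1 →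
    ENNReal.ofReal (C * (R / r) ^ s) ≤
      ⨅ x : X, (closedBallCoveringNumber r (Metric.closedBall x R) : ℝ≥0∞)

/-- The monotone lower spectrum (also called quasi-lower spectrum) of the metric space `X` at
`0 < θ < 1`: the supremum, in `[0, ∞]`, of the admissible exponents `s ≥ 0`. -/
noncomputable def monotoneLowerSpectrum (X : Type*) [MetricSpace X] (θ : ℝ) : ℝ≥0∞ :=
  ⨆ (s : ℝ≥0) (_ : IsMonotoneLowerExponent X θ s), (s : ℝ≥0∞)

/-- `(1 - θ)` times the monotone lower spectrum of `X` at `θ`, for `0 < θ ≤ 1`. The spectrum itself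
is only defined for `θ < 1`; at `θ = 1` the product means `0` by convention. -/
noncomputable def scaledMonotoneLowerSpectrum (X : Type*) [MetricSpace X] (θ : ℝ) : ℝ≥0∞ :=
  if θ = 1 then 0 else ENNReal.ofReal (1 - θ) * monotoneLowerSpectrum X θ

/-- The continuous function of `θ ∈ (0, 1]` with two affine pieces that joins the points `(0, α)`,
`(l, t)` and `(1, 0)`, for `0 < l ≤ 1` and `0 ≤ t ≤ α (1 - l)`. -/
noncomputable def twoPieceAffine (α l t θ : ℝ) : ℝ :=
  if θ ≤ l then α + θ / l * (t - α) else t * ((1 - θ) / (1 - l))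

/-!
A profile `φ` with codimension `δ θ = D - φ θ / (1 - θ)` is characterised by two opposite
monotonicities: `δ` increases and `(1 / θ - 1) * δ θ` decreases. Both are necessary: enlarging `θ`
allows more pairs of scales, and in the other direction a lower bound at `θ` gives one at `η ≥ θ`,
because the radius `r` may be refined to `r ^ (η / θ)` at the cost of the Assouad bound.

Conversely, take the dyadic rationals and put, at distance about `2 ^ (-a)` from a copy of them, a
piece whose binary digits between the places `a` and `b` are thinned to codimension `δ (a / b)`.
The pair of scales `2 ^ (-b) < 2 ^ (-a)` bounds the spectrum at `a / b` from above, and the two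
monotonicities say exactly that this piece does not violate the required lower bound at any other
`θ`. In dimension `D` a power of this subset of the line does the same.

Finally, the conditions pass to infima, the two-piece functions satisfy them, and every profile lies
below the two-piece function that touches it at a given point.
-/

/-- The conditions characterising `(1 - θ)` times the monotone lower spectrum of a subset of a
`D`-dimensional space. The inequality `φ (l * θ) - θ * φ l ≤ (1 - θ) * D` for all `l` and `θ` is
encoded as a monotonicity in the last field. -/
structure IsSpectrumProfile (D : ℝ) (φ : ℝ → ℝ) : Prop where
  antitoneOn_div_one_sub : AntitoneOn (fun θ => φ θ / (1 - θ)) (Set.Ioo 0 1)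
  map_one : φ 1 = 0
  antitoneOn_sub_div : AntitoneOn (fun θ => (D - φ θ) / θ) (Set.Ioc 0 1)

theorem antitoneOn_sub_div_iff {D : ℝ} {φ : ℝ → ℝ} :
    AntitoneOn (fun θ => (D - φ θ) / θ) (Set.Ioc 0 1) ↔
      ∀ l ∈ Set.Ioc (0 : ℝ) 1, ∀ θ ∈ Set.Ioc (0 : ℝ) 1, φ (l * θ) - θ * φ l ≤ (1 - θ) * D := by
  constructor
  · intro h l hl θ hθ
    have hlθ : l * θ ≤ l := mul_le_of_le_one_right hl.1.le hθ.2
    have h' : (D - φ l) / l ≤ (D - φ (l * θ)) / (l * θ) :=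
      h ⟨mul_pos hl.1 hθ.1, hlθ.trans hl.2⟩ hl hlθ
    rw [← div_div, div_right_comm, div_le_div_iff_of_pos_right hl.1, le_div_iff₀ hθ.1] at h'
    linarith
  · intro h a ha b hb hab
    have h' := h b hb (a / b) ⟨div_pos ha.1 hb.1, (div_le_one hb.1).2 hab⟩
    rw [mul_div_cancel₀ _ hb.1.ne'] at h'
    change (D - φ b) / b ≤ (D - φ a) / a
    rw [le_div_iff₀ ha.1, div_mul_eq_mul_div, mul_div_right_comm, mul_comm, ← sub_nonneg]
    linear_combination h'

theorem isSpectrumProfile_iff {D : ℝ} {φ : ℝ → ℝ} :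
    IsSpectrumProfile D φ ↔
      AntitoneOn (fun θ => φ θ / (1 - θ)) (Set.Ioo 0 1) ∧ φ 1 = 0 ∧
        ∀ l ∈ Set.Ioc (0 : ℝ) 1, ∀ θ ∈ Set.Ioc (0 : ℝ) 1,
          φ (l * θ) - θ * φ l ≤ (1 - θ) * D := by
  rw [← antitoneOn_sub_div_iff]
  exact ⟨fun h => ⟨h.1, h.2, h.3⟩, fun h => ⟨h.1, h.2.1, h.2.2⟩⟩

namespace IsSpectrumProfile

variable {D : ℝ} {φ : ℝ → ℝ}

theorem le_mul_one_sub (h : IsSpectrumProfile D φ) {θ : ℝ} (hθ : θ ∈ Set.Ioc (0 : ℝ) 1) :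
    φ θ ≤ D * (1 - θ) := by
  have h' : (D - φ 1) / 1 ≤ (D - φ θ) / θ := h.antitoneOn_sub_div hθ ⟨one_pos, le_rfl⟩ hθ.2
  rw [h.map_one, le_div_iff₀ hθ.1] at h'
  linarith

theorem apply_div_mul_le (h : IsSpectrumProfile D φ) {θ : ℝ} (hθ : θ ∈ Set.Ioc (0 : ℝ) 1) {a b : ℝ}
    (ha : 0 < a) (hab : a ≤ θ * b) : φ (a / b) * b ≤ D * b - a * ((D - φ θ) / θ) := by
  have hb : 0 < b := pos_of_mul_pos_right (ha.trans_le hab) hθ.1.le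
  have hq : a / b ≤ θ := (div_le_iff₀ hb).2 hab
  have h' : (D - φ θ) / θ ≤ (D - φ (a / b)) / (a / b) :=
    h.antitoneOn_sub_div ⟨div_pos ha hb, hq.trans hθ.2⟩ hθ hq
  rw [div_div_eq_mul_div, le_div_iff₀ ha] at h'
  linarith

theorem apply_floor_div_mul_le (h : IsSpectrumProfile D φ) (hD : 0 ≤ D) {θ : ℝ}
    (hθ : θ ∈ Set.Ioc (0 : ℝ) 1) {b : ℝ} (hb : 1 ≤ θ * b) :
    φ (⌊θ * b⌋₊ / b) * b ≤ φ θ * b + (D - φ θ) / θ := by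
  set u := (D - φ θ) / θ
  have hu : 0 ≤ u := by
    have := h.le_mul_one_sub hθ
    exact div_nonneg (by linarith [mul_nonneg hD hθ.1.le]) hθ.1.le
  have hθu : θ * u = D - φ θ := mul_div_cancel₀ _ hθ.1.ne'
  have hmul : φ (⌊θ * b⌋₊ / b) * b ≤ D * b - ⌊θ * b⌋₊ * u :=
    h.apply_div_mul_le hθ (Nat.cast_pos.2 (Nat.floor_pos.2 hb))
      (Nat.floor_le (zero_le_one.trans hb))
  have hfloor : (θ * b - 1) * u ≤ ⌊θ * b⌋₊ * u :=
    mul_le_mul_of_nonneg_right (Nat.sub_one_lt_floor _).le hu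
  linear_combination hmul + hfloor - b * hθu

theorem div_const (h : IsSpectrumProfile D φ) (hD : 0 ≤ D) :
    IsSpectrumProfile 1 (fun θ => φ θ / D) := by
  rcases hD.eq_or_lt with rfl | hD
  · simp only [div_zero]
    refine ⟨fun _ _ _ _ _ => by simp, rfl, fun a ha b _ hab => ?_⟩
    simpa using inv_anti₀ ha.1 hab
  · refine ⟨fun a ha b hb hab => ?_, by simp [h.map_one], fun a ha b hb hab => ?_⟩
    · simpa only [div_right_comm _ D] using
        div_le_div_of_nonneg_right (h.antitoneOn_div_one_sub ha hb hab) hD.le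
    · simpa only [div_right_comm _ _ D, sub_div, div_self hD.ne'] using
        div_le_div_of_nonneg_right (h.antitoneOn_sub_div ha hb hab) hD.le

theorem of_isGLB {ι : Type*} {S : Set ι} {f : ι → ℝ → ℝ} (hS : S.Nonempty)
    (hf : ∀ i ∈ S, IsSpectrumProfile D (f i))
    (hφ : ∀ θ ∈ Set.Ioc (0 : ℝ) 1, IsGLB ((fun i => f i θ) '' S) (φ θ)) :
    IsSpectrumProfile D φ := by
  have lower : ∀ {θ}, θ ∈ Set.Ioc (0 : ℝ) 1 → ∀ i ∈ S, φ θ ≤ f i θ :=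
    fun hθ i hi => (hφ _ hθ).1 (Set.mem_image_of_mem _ hi)
  have greatest : ∀ {θ c}, θ ∈ Set.Ioc (0 : ℝ) 1 → (∀ i ∈ S, c ≤ f i θ) → c ≤ φ θ :=
    fun hθ hc => (hφ _ hθ).2 (Set.forall_mem_image.2 hc)
  refine ⟨fun a ha b hb hab => ?_, ?_, fun a ha b hb hab => ?_⟩
  · have hb' : 0 ≤ 1 - b := sub_nonneg.2 hb.2.le
    change φ b / (1 - b) ≤ φ a / (1 - a)
    rw [le_div_iff₀ (sub_pos.2 ha.2)]
    refine greatest ⟨ha.1, ha.2.le⟩ fun i hi => ?_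
    rw [← le_div_iff₀ (sub_pos.2 ha.2)]
    exact (div_le_div_of_nonneg_right (lower ⟨hb.1, hb.2.le⟩ i hi) hb').trans
      ((hf i hi).antitoneOn_div_one_sub ha hb hab)
  · have h1 : (1 : ℝ) ∈ Set.Ioc 0 1 := ⟨one_pos, le_rfl⟩
    obtain ⟨i, hi⟩ := hS
    exact ((lower h1 i hi).trans_eq (hf i hi).map_one).antisymm
      (greatest h1 fun j hj => (hf j hj).map_one.ge)
  · change (D - φ b) / b ≤ (D - φ a) / a
    rw [div_le_iff₀ hb.1, sub_le_comm]
    refine greatest hb fun i hi => ?_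
    rw [sub_le_comm, ← div_le_iff₀ hb.1]
    refine ((hf i hi).antitoneOn_sub_div ha hb hab).trans ?_
    exact div_le_div_of_nonneg_right (sub_le_sub_left (lower ha i hi) D) ha.1.le

end IsSpectrumProfile

section twoPieceAffine

variable {D l t : ℝ}

theorem twoPieceAffine_self (hl : l ≠ 0) : twoPieceAffine D l t l = t := by
  simp [twoPieceAffine, div_self hl]

theorem twoPieceAffine_eq_max {θ : ℝ} (hD : 0 ≤ D) (hl : l ∈ Set.Ioc (0 : ℝ) 1)
    (ht : t ∈ Set.Icc (0 : ℝ) (D * (1 - l))) (hθ : θ ∈ Set.Ioc (0 : ℝ) 1) :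
    twoPieceAffine D l t θ = max (D - θ * ((D - t) / l)) (t / (1 - l) * (1 - θ)) := by
  obtain ⟨hl0, hl1⟩ := hl
  have hfirst : D + θ / l * (t - D) = D - θ * ((D - t) / l) := by ring
  have hsecond : t * ((1 - θ) / (1 - l)) = t / (1 - l) * (1 - θ) := by ring
  rw [twoPieceAffine, hfirst, hsecond]
  rcases hl1.eq_or_lt with rfl | hl1
  · simp only [hθ.2, if_true, sub_self, div_zero, zero_mul, div_one]
    rw [max_eq_left]
    linarith [mul_nonneg hD (sub_nonneg.2 hθ.2), mul_nonneg hθ.1.le ht.1]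
  · have hl1' : 0 < 1 - l := sub_pos.2 hl1
    have hgap : t / (1 - l) * (1 - θ) - (D - θ * ((D - t) / l)) =
        (θ - l) * ((D * (1 - l) - t) / (l * (1 - l))) := by
      field_simp
      ring
    have hc : 0 ≤ (D * (1 - l) - t) / (l * (1 - l)) :=
      div_nonneg (sub_nonneg.2 ht.2) (mul_pos hl0 hl1').le
    split_ifs with hθl
    · rw [max_eq_left]
      nlinarith
    · rw [max_eq_right]
      nlinarith

theorem isSpectrumProfile_twoPieceAffine (hD : 0 ≤ D) (hl : l ∈ Set.Ioc (0 : ℝ) 1)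
    (ht : t ∈ Set.Icc (0 : ℝ) (D * (1 - l))) :
    IsSpectrumProfile D (twoPieceAffine D l t) := by
  set c := (D - t) / l with hc
  set u := t / (1 - l)
  have hDc : D ≤ c := by
    rw [hc, le_div_iff₀ hl.1]
    linarith [ht.2]
  have huD : u ≤ D := div_le_of_le_mul₀ (sub_nonneg.2 hl.2) hD ht.2
  have hmax : ∀ {θ}, θ ∈ Set.Ioc (0 : ℝ) 1 →
      twoPieceAffine D l t θ = max (D - θ * c) (u * (1 - θ)) :=
    fun hθ => twoPieceAffine_eq_max hD hl ht hθ
  refine ⟨?_, ?_, ?_⟩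
  · have hfirst : AntitoneOn (fun θ => (D - θ * c) / (1 - θ)) (Set.Ioo 0 1) := by
      intro a ha b hb hab
      rw [div_le_div_iff₀ (sub_pos.2 hb.2) (sub_pos.2 ha.2)]
      nlinarith
    refine (hfirst.max (antitoneOn_const (c := u))).congr fun θ hθ => ?_
    rw [hmax ⟨hθ.1, hθ.2.le⟩, ← max_div_div_right (sub_pos.2 hθ.2).le,
      mul_div_cancel_right₀ _ (sub_pos.2 hθ.2).ne']
  · rw [hmax ⟨one_pos, le_rfl⟩, sub_self, mul_zero, one_mul, max_eq_right (sub_nonpos.2 hDc)]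
  · have hsecond : AntitoneOn (fun θ => (D - u * (1 - θ)) / θ) (Set.Ioc 0 1) := by
      intro a ha b hb hab
      rw [div_le_div_iff₀ hb.1 ha.1]
      nlinarith
    refine ((antitoneOn_const (c := c)).min hsecond).congr fun θ hθ => ?_
    rw [hmax hθ, ← min_sub_sub_left, sub_sub_cancel, ← min_div_div_right hθ.1.le,
      mul_div_cancel_left₀ _ hθ.1.ne']

theorem IsSpectrumProfile.le_twoPieceAffine {φ : ℝ → ℝ} (h : IsSpectrumProfile D φ) {θ : ℝ}
    (hl : l ∈ Set.Ioc (0 : ℝ) 1) (hθ : θ ∈ Set.Ioc (0 : ℝ) 1) :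
    φ θ ≤ twoPieceAffine D l (φ l) θ := by
  rw [twoPieceAffine]
  split_ifs with hθl
  · have h' : (D - φ l) / l ≤ (D - φ θ) / θ := h.antitoneOn_sub_div hθ hl hθl
    rw [le_div_iff₀ hθ.1] at h'
    linear_combination h'
  · rcases hθ.2.eq_or_lt with rfl | hθ1
    · simp [h.map_one]
    · have h' : φ θ / (1 - θ) ≤ φ l / (1 - l) :=
        h.antitoneOn_div_one_sub ⟨hl.1, by linarith⟩ ⟨hθ.1, hθ1⟩ (not_le.1 hθl).le
      rw [div_le_iff₀ (sub_pos.2 hθ1)] at h'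
      linear_combination h'

theorem isSpectrumProfile_iff_exists_isGLB {φ : ℝ → ℝ} (hD : 0 ≤ D)
    (hφ : ∀ θ ∈ Set.Ioc (0 : ℝ) 1, 0 ≤ φ θ) :
    IsSpectrumProfile D φ ↔
      ∃ S : Set (ℝ × ℝ), S.Nonempty ∧
        (∀ p ∈ S, p.1 ∈ Set.Ioc (0 : ℝ) 1 ∧ p.2 ∈ Set.Icc (0 : ℝ) (D * (1 - p.1))) ∧
        ∀ θ ∈ Set.Ioc (0 : ℝ) 1,
          IsGLB ((fun p : ℝ × ℝ => twoPieceAffine D p.1 p.2 θ) '' S) (φ θ) := by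
  constructor
  · intro h
    refine ⟨(fun l => (l, φ l)) '' Set.Ioc 0 1, (Set.nonempty_Ioc.2 one_pos).image _,
      Set.forall_mem_image.2 fun l hl => ⟨hl, hφ l hl, h.le_mul_one_sub hl⟩, fun θ hθ => ?_⟩
    rw [Set.image_image]
    refine IsLeast.isGLB ⟨⟨θ, hθ, twoPieceAffine_self hθ.1.ne'⟩, ?_⟩
    exact Set.forall_mem_image.2 fun l hl => h.le_twoPieceAffine hl hθ
  · rintro ⟨S, hS, hmem, hglb⟩
    exact .of_isGLB hS (fun p hp => isSpectrumProfile_twoPieceAffine hD (hmem p hp).1 (hmem p hp).2)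
      hglb

end twoPieceAffine

section CoveringNumber

variable {X : Type*} [MetricSpace X] {r : ℝ} {E : Set X}

theorem isCover_toNNReal_iff (hr : 0 ≤ r) {N : Set X} :
    Metric.IsCover r.toNNReal E N ↔ ∀ z ∈ E, ∃ w ∈ N, dist z w ≤ r := by
  simp [Metric.isCover_iff_subset_iUnion_closedBall, Set.subset_def, Real.coe_toNNReal r hr]

theorem closedBallCoveringNumber_le_ofReal_iff (hr : 0 ≤ r) {v : ℝ} (hv : 0 ≤ v) :
    (closedBallCoveringNumber r E : ℝ≥0∞) ≤ ENNReal.ofReal v ↔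
      ∃ T : Finset X, (T.card : ℝ) ≤ v ∧ ∀ z ∈ E, ∃ w ∈ T, dist z w ≤ r := by
  have hcard : ∀ T : Finset X, ((T.card : ℕ∞) : ℝ≥0∞) ≤ ENNReal.ofReal v ↔ (T.card : ℝ) ≤ v := by
    intro T
    rw [ENat.toENNReal_coe, ← ENNReal.ofReal_natCast, ENNReal.ofReal_le_ofReal_iff hv]
  constructor
  · intro h
    have hne : closedBallCoveringNumber r E ≠ ⊤ := by
      rintro htop
      simp [htop] at h
    have : Nonempty {N : Set X // Metric.IsCover r.toNNReal E N} := ⟨⟨E, by simp⟩⟩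
    obtain ⟨⟨N, hN⟩, hNeq⟩ := ENat.exists_eq_iInf
      fun N : {N : Set X // Metric.IsCover r.toNNReal E N} => N.1.encard
    rw [iInf_subtype] at hNeq
    change N.encard = closedBallCoveringNumber r E at hNeq
    have hfin : N.Finite := Set.encard_ne_top_iff.1 (hNeq ▸ hne)
    refine ⟨hfin.toFinset, ?_, by simpa using (isCover_toNNReal_iff hr).1 hN⟩
    rw [← hcard, ← hfin.encard_eq_coe_toFinset_card, hNeq]
    exact h
  · rintro ⟨T, hTv, hT⟩
    refine le_trans ?_ ((hcard T).2 hTv)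
    have hcover : Metric.IsCover r.toNNReal E (T : Set X) := (isCover_toNNReal_iff hr).2 hT
    rw [← Set.encard_coe_eq_coe_finsetCard]
    exact ENat.toENNReal_le.2 hcover.externalCoveringNumber_le_encard

theorem ofReal_le_closedBallCoveringNumber_iff (hr : 0 ≤ r) {v : ℝ} :
    ENNReal.ofReal v ≤ (closedBallCoveringNumber r E : ℝ≥0∞) ↔
      ∀ T : Finset X, (∀ z ∈ E, ∃ w ∈ T, dist z w ≤ r) → v ≤ T.card := by
  constructor
  · intro h T hT
    have hcard := (closedBallCoveringNumber_le_ofReal_iff hr T.card.cast_nonneg).2 ⟨T, le_rfl, hT⟩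
    exact (ENNReal.ofReal_le_ofReal_iff T.card.cast_nonneg).1 (h.trans hcard)
  · intro h
    by_contra! hlt
    obtain ⟨n, hn⟩ := ENat.ne_top_iff_exists.1 (ENat.toENNReal_ne_top.1 hlt.ne_top)
    rw [← hn, ENat.toENNReal_coe, ← ENNReal.ofReal_natCast] at hlt
    obtain ⟨T, hTn, hT⟩ := (closedBallCoveringNumber_le_ofReal_iff hr n.cast_nonneg).1
      (by rw [← hn, ENat.toENNReal_coe, ENNReal.ofReal_natCast])
    exact absurd ((h T hT).trans hTn) (not_le.2 (ENNReal.ofReal_lt_ofReal_iff'.1 hlt).1)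

theorem closedBallCoveringNumber_mono {E' : Set X} (h : E ⊆ E') :
    closedBallCoveringNumber r E ≤ closedBallCoveringNumber r E' :=
  Metric.externalCoveringNumber_mono_set h

theorem closedBallCoveringNumber_le_of_forall_separated {v : ℝ} (hr : 0 ≤ r)
    (h : ∀ T : Finset X, (T : Set X) ⊆ E → (T : Set X).Pairwise (fun x y => r < dist x y) →
      (T.card : ℝ) ≤ v) :
    (closedBallCoveringNumber r E : ℝ≥0∞) ≤ ENNReal.ofReal v := by
  have hpack : Metric.packingNumber r.toNNReal E ≤ (⌊v⌋₊ : ℕ) := by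
    refine iSup_le fun N => iSup₂_le fun hNE hsep => ?_
    have hfin : ∀ T : Finset X, (T : Set X) ⊆ N → T.card ≤ ⌊v⌋₊ := by
      refine fun T hT => Nat.le_floor (h T (hT.trans hNE) fun x hx y hy hxy => ?_)
      have hlt : ENNReal.ofReal r < edist x y := hsep (hT hx) (hT hy) hxy
      rw [edist_dist] at hlt
      exact (ENNReal.ofReal_lt_ofReal_iff_of_nonneg hr).1 hlt
    rcases N.finite_or_infinite with hN | hN
    · rw [hN.encard_eq_coe_toFinset_card]
      exact_mod_cast hfin hN.toFinset (by simp)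
    · obtain ⟨T, hT, hTcard⟩ := hN.exists_subset_card_eq (⌊v⌋₊ + 1)
      exact absurd (hfin T hT) (by omega)
  have hcover : closedBallCoveringNumber r E ≤ (⌊v⌋₊ : ℕ) :=
    ((Metric.externalCoveringNumber_le_coveringNumber _ _).trans
      (Metric.coveringNumber_le_packingNumber _ _)).trans hpack
  have hv : 0 ≤ v := by simpa using h ∅ (by simp) (by simp)
  refine (ENat.toENNReal_le.2 hcover).trans ?_
  rw [ENat.toENNReal_coe, ← ENNReal.ofReal_natCast]
  exact ENNReal.ofReal_le_ofReal (Nat.floor_le hv)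

end CoveringNumber

/-- The Assouad dimension bound with exponent `D`, attained: up to a constant, every ball of radius
`ρ` is covered by `(ρ / r) ^ D` balls of radius `r ≤ ρ`. -/
def HasAssouadBound (X : Type*) [MetricSpace X] (D : ℝ) : Prop :=
  ∃ K : ℝ, 0 < K ∧ ∀ (x : X) (r ρ : ℝ), 0 < r → r ≤ ρ →
    (closedBallCoveringNumber r (Metric.closedBall x ρ) : ℝ≥0∞) ≤ ENNReal.ofReal (K * (ρ / r) ^ D)

theorem HasAssouadBound.exists_ofReal_div_le {X : Type*} [MetricSpace X] {D : ℝ}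
    (h : HasAssouadBound X D) :
    ∃ K : ℝ, 0 < K ∧ ∀ (r ρ v : ℝ) (E : Set X), 0 < r → r ≤ ρ →
      ENNReal.ofReal v ≤ closedBallCoveringNumber r E →
      ENNReal.ofReal (v / (K * (ρ / r) ^ D)) ≤ closedBallCoveringNumber ρ E := by
  classical
  obtain ⟨K, hK, hcover⟩ := h
  refine ⟨K, hK, fun r ρ v E hr hρ hv => ?_⟩
  have hk : 0 < K * (ρ / r) ^ D :=
    mul_pos hK (Real.rpow_pos_of_pos (div_pos (hr.trans_le hρ) hr) D)
  rw [ofReal_le_closedBallCoveringNumber_iff (hr.le.trans hρ)]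
  intro T hT
  choose G hGcard hG using fun x : X =>
    (closedBallCoveringNumber_le_ofReal_iff hr.le hk.le).1 (hcover x r ρ hr hρ)
  have hv' : v ≤ (T.biUnion G).card := by
    refine (ofReal_le_closedBallCoveringNumber_iff hr.le).1 hv _ fun z hz => ?_
    obtain ⟨y, hy, hzy⟩ := hT z hz
    obtain ⟨w, hw, hzw⟩ := hG y z hzy
    exact ⟨w, Finset.mem_biUnion.2 ⟨y, hy, hw⟩, hzw⟩
  rw [div_le_iff₀ hk]
  calc v ≤ ((∑ y ∈ T, (G y).card : ℕ) : ℝ) :=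
        hv'.trans (Nat.cast_le.2 Finset.card_biUnion_le)
    _ ≤ ∑ _y ∈ T, K * (ρ / r) ^ D := by
        push_cast
        exact Finset.sum_le_sum fun y _ => hGcard y
    _ = T.card * (K * (ρ / r) ^ D) := by simp

section FiniteDimensional

open MeasureTheory Module

variable {E : Type*} [NormedAddCommGroup E] [NormedSpace ℝ E] [FiniteDimensional ℝ E]

theorem card_le_of_separated_closedBall {T : Finset E} {x : E} {r ρ : ℝ} (hr : 0 < r)
    (hρ : r ≤ ρ) (hT : (T : Set E) ⊆ Metric.closedBall x ρ)
    (hsep : (T : Set E).Pairwise fun y z => r < dist y z) :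
    (T.card : ℝ) ≤ (4 * ρ / r) ^ finrank ℝ E := by
  borelize E
  let μ : Measure E := Measure.addHaar
  set n := finrank ℝ E
  have hdisj : (T : Set E).Pairwise (Function.onFun Disjoint fun y => Metric.ball y (r / 2)) :=
    fun y hy z hz hyz => Metric.ball_disjoint_ball (by linarith [hsep hy hz hyz])
  have hsub : ⋃ y ∈ T, Metric.ball y (r / 2) ⊆ Metric.ball x (ρ + r) :=
    Set.iUnion₂_subset fun y hy =>
      Metric.ball_subset_ball' (by linarith [Metric.mem_closedBall.1 (hT hy)])
  have hμball : ∀ (y : E) {a : ℝ}, 0 < a →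
      μ (Metric.ball y a) = ENNReal.ofReal (a ^ n) * μ (Metric.ball 0 1) :=
    fun y a ha => Measure.addHaar_ball_of_pos μ y ha
  have hvolume : (T.card : ℝ≥0∞) * ENNReal.ofReal ((r / 2) ^ n) * μ (Metric.ball 0 1) ≤
      ENNReal.ofReal ((ρ + r) ^ n) * μ (Metric.ball 0 1) := by
    calc (T.card : ℝ≥0∞) * ENNReal.ofReal ((r / 2) ^ n) * μ (Metric.ball 0 1)
        = μ (⋃ y ∈ T, Metric.ball y (r / 2)) := by
          rw [measure_biUnion_finset hdisj fun y _ => measurableSet_ball]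
          simp only [hμball _ (half_pos hr), Finset.sum_const, nsmul_eq_mul, mul_assoc]
      _ ≤ μ (Metric.ball x (ρ + r)) := measure_mono hsub
      _ = _ := hμball x (by linarith)
  have hcard : (T.card : ℝ) * (r / 2) ^ n ≤ (ρ + r) ^ n := by
    rw [ENNReal.mul_le_mul_iff_left (Metric.measure_ball_pos _ _ zero_lt_one).ne'
      measure_ball_lt_top.ne, ← ENNReal.ofReal_natCast, ← ENNReal.ofReal_mul (by positivity),
      ENNReal.ofReal_le_ofReal_iff (pow_nonneg (by linarith) _)] at hvolume
    exact hvolume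
  calc (T.card : ℝ) ≤ ((ρ + r) / (r / 2)) ^ n := by
        rwa [div_pow, le_div_iff₀ (pow_pos (half_pos hr) n)]
    _ ≤ (4 * ρ / r) ^ n := by
        have h4 : (ρ + r) / (r / 2) ≤ 4 * ρ / r := by
          rw [div_le_div_iff₀ (half_pos hr) hr]
          nlinarith
        exact pow_le_pow_left₀ (div_nonneg (by linarith) (half_pos hr).le) h4 n

theorem hasAssouadBound_subtype (F : Set E) : HasAssouadBound F (finrank ℝ E) := by
  refine ⟨4 ^ finrank ℝ E, by positivity, fun x r ρ hr hρ => ?_⟩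
  refine closedBallCoveringNumber_le_of_forall_separated hr.le fun T hT hsep => ?_
  rw [Real.rpow_natCast, ← mul_pow, ← mul_div_assoc,
    ← Finset.card_map (Function.Embedding.subtype (· ∈ F))]
  refine card_le_of_separated_closedBall (x := (x : E)) hr hρ ?_ ?_
  · rw [Finset.coe_map]
    exact Set.image_subset_iff.2 hT
  · rw [Finset.coe_map]
    exact (Set.InjOn.pairwise_image Subtype.val_injective.injOn).2 hsep

end FiniteDimensional

theorem le_of_eventually_mul_two_rpow_le {c K a b : ℝ} (hc : 0 < c)
    (h : ∀ᶠ n : ℕ in Filter.atTop, c * 2 ^ (a * n) ≤ K * 2 ^ (b * n)) : a ≤ b := by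
  by_contra! hab
  have hone : 1 < (2 : ℝ) ^ (a - b) := Real.one_lt_rpow one_lt_two (sub_pos.2 hab)
  obtain ⟨n, hn, hlarge⟩ :=
    (h.and ((tendsto_pow_atTop_atTop_of_one_lt hone).eventually_gt_atTop (K / c))).exists
  rw [← Real.rpow_mul_natCast zero_le_two, sub_mul, Real.rpow_sub two_pos,
    div_lt_div_iff₀ hc (Real.rpow_pos_of_pos two_pos _)] at hlarge
  linarith

theorem half_pow_div_half_pow (m n : ℕ) :
    (1 / 2 : ℝ) ^ m / (1 / 2) ^ n = 2 ^ ((n : ℝ) - m) := by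
  rw [Real.rpow_sub two_pos, Real.rpow_natCast, Real.rpow_natCast, one_div_pow, one_div_pow,
    div_div_eq_mul_div, mul_comm, ← mul_div_assoc, mul_one, div_one]

theorem exists_mul_half_pow_lt {A R : ℝ} (hR : 0 < R) (hRA : R ≤ A) :
    ∃ m : ℕ, A * (1 / 2) ^ m < R ∧ R ≤ 2 * A * (1 / 2) ^ m := by
  have hA : 0 < A := hR.trans_le hRA
  obtain ⟨m, hm, hm'⟩ := exists_nat_pow_near_of_lt_one (div_pos hR hA) ((div_le_one hA).2 hRA)
    one_half_pos one_half_lt_one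
  rw [lt_div_iff₀ hA] at hm
  rw [div_le_iff₀ hA] at hm'
  refine ⟨m + 1, by linarith, ?_⟩
  rw [pow_succ]
  linarith

theorem exists_dyadic_scales {θ A : ℝ} (hθ : 0 < θ) (hθ1 : θ ≤ 1) (hA : 1 ≤ A) :
    ∃ B : ℝ, 0 < B ∧ ∀ r R : ℝ, 0 < r → r ^ θ ≤ R → R ≤ 1 →
      ∃ m n : ℕ, m ≤ θ * n ∧ A * (1 / 2) ^ m ≤ R ∧ (1 / 2) ^ n ≤ r ∧ r ≤ B * (1 / 2) ^ n ∧
        R / r ≤ 2 ^ ((n : ℝ) - m) := by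
  have h2A : 1 ≤ 2 * A := by linarith
  set B := (2 * A) ^ (1 / θ) with hB
  have hBA : 2 * A ≤ B := Real.self_le_rpow_of_one_le h2A (one_le_one_div hθ hθ1)
  have hBθ : B ^ θ = 2 * A := by
    rw [hB, ← Real.rpow_mul (by positivity), one_div_mul_cancel hθ.ne', Real.rpow_one]
  refine ⟨2 * B, by linarith, fun r R hr hrR hR1 => ?_⟩
  have hr1 : r ≤ 1 := by
    by_contra! hr1
    exact (hrR.trans hR1).not_gt (Real.one_lt_rpow hr1 hθ)
  obtain ⟨m, hmR, hRm⟩ := exists_mul_half_pow_lt ((Real.rpow_pos_of_pos hr θ).trans_le hrR)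
    (hR1.trans hA)
  obtain ⟨n, hnr, hrn⟩ := exists_mul_half_pow_lt hr (hr1.trans (h2A.trans hBA))
  have hB1 : 1 ≤ B := h2A.trans hBA
  have hhalfn : (0 : ℝ) < (1 / 2) ^ n := by positivity
  refine ⟨m, n, ?_, hmR.le, (le_mul_of_one_le_left hhalfn.le hB1).trans hnr.le, hrn, ?_⟩
  · have hpow : ((1 : ℝ) / 2) ^ (θ * n) < (1 / 2) ^ (m : ℝ) := by
      rw [mul_comm, Real.rpow_mul (by norm_num), Real.rpow_natCast, Real.rpow_natCast]
      refine lt_of_mul_lt_mul_left ?_ (zero_le_one.trans h2A)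
      calc 2 * A * ((1 / 2) ^ n) ^ θ = (B * (1 / 2) ^ n) ^ θ := by
            rw [Real.mul_rpow (by positivity) hhalfn.le, hBθ]
        _ < r ^ θ := Real.rpow_lt_rpow (by positivity) hnr hθ
        _ ≤ 2 * A * (1 / 2) ^ m := hrR.trans hRm
    exact ((Real.rpow_lt_rpow_left_iff_of_base_lt_one one_half_pos one_half_lt_one).1 hpow).le
  · rw [← half_pow_div_half_pow, div_le_div_iff₀ hr hhalfn]
    calc R * (1 / 2) ^ n ≤ 2 * A * (1 / 2) ^ m * (1 / 2) ^ n := by gcongr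
      _ ≤ B * (1 / 2) ^ m * (1 / 2) ^ n := by gcongr
      _ = (1 / 2) ^ m * (B * (1 / 2) ^ n) := by ring
      _ ≤ (1 / 2) ^ m * r := by gcongr

theorem rpow_mul_rpow_le_of_codimension_le {D θ η s s' r R : ℝ} (hθ : 0 < θ) (hθη : θ ≤ η)
    (hη : η < 1) (hsD : s ≤ D) (h : (1 - θ) / θ * (D - s) ≤ (1 - η) / η * (D - s'))
    (hr : 0 < r) (hr1 : r ≤ 1) (hR : r ^ η ≤ R) :
    (R / r) ^ s' * (r / r ^ (η / θ)) ^ D ≤ (R / r ^ (η / θ)) ^ s := by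
  have hη0 : 0 < η := hθ.trans_le hθη
  have hgap : (η / θ - 1) * (D - s) ≤ (1 - η) * (s - s') := by
    have := mul_le_mul_of_nonneg_left h hη0.le
    field_simp at this ⊢
    linarith
  have hss : 0 ≤ s - s' := by
    have : 0 ≤ (η / θ - 1) * (D - s) :=
      mul_nonneg (sub_nonneg.2 ((one_le_div hθ).2 hθη)) (sub_nonneg.2 hsD)
    exact nonneg_of_mul_nonneg_right (this.trans hgap) (sub_pos.2 hη)
  have hR0 : 0 < R := (Real.rpow_pos_of_pos hr η).trans_le hR
  have hr'0 : 0 < r ^ (η / θ) := Real.rpow_pos_of_pos hr _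
  have hlogR : η * Real.log r ≤ Real.log R := by
    rw [← Real.log_rpow hr]
    exact Real.log_le_log (Real.rpow_pos_of_pos hr η) hR
  have hlogr : Real.log r ≤ 0 := Real.log_nonpos hr.le hr1
  rw [← Real.log_le_log_iff (by positivity) (by positivity),
    Real.log_mul (by positivity) (by positivity), Real.log_rpow (by positivity),
    Real.log_rpow (by positivity), Real.log_rpow (by positivity),
    Real.log_div hR0.ne' hr.ne', Real.log_div hr.ne' hr'0.ne', Real.log_div hR0.ne' hr'0.ne',
    Real.log_rpow hr]
  nlinarith [mul_nonneg hss (sub_nonneg.2 hlogR),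
    mul_nonneg (sub_nonneg.2 hgap) (neg_nonneg.2 hlogr)]

namespace IsMonotoneLowerExponent

variable {X : Type*} [MetricSpace X] {D θ s : ℝ}

theorem antitone {η : ℝ} (hs : IsMonotoneLowerExponent X η s) (hθη : θ ≤ η)
    (hη : η ≤ 1) : IsMonotoneLowerExponent X θ s := by
  obtain ⟨C, hC, hcover⟩ := hs
  refine ⟨C, hC, fun r R hr hrθ hR hR1 => ?_⟩
  have hr1 : r ≤ 1 := (hrθ.trans hR).trans hR1.le
  refine hcover r R hr ?_ ((Real.rpow_le_rpow_of_exponent_ge hr hr1 hθη).trans hR) hR1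
  simpa using Real.rpow_le_rpow_of_exponent_ge hr hr1 hη

theorem exists_dyadic (hX : HasAssouadBound X D) (hs : IsMonotoneLowerExponent X θ s)
    (hθ : θ ≤ 1) {A : ℝ} (hA : 1 ≤ A) :
    ∃ C : ℝ, 0 < C ∧ ∀ (x : X) (m n : ℕ), 0 < m → m ≤ θ * n →
      ENNReal.ofReal (C * 2 ^ (s * (n - m))) ≤
        closedBallCoveringNumber (A * (1 / 2) ^ n) (Metric.closedBall x ((1 / 2) ^ m)) := by
  obtain ⟨K, hK, hcompare⟩ := hX.exists_ofReal_div_le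
  obtain ⟨C, hC, hcover⟩ := hs
  have hA0 : 0 < A := one_pos.trans_le hA
  refine ⟨C / (K * A ^ D), by positivity, fun x m n hm hmn => ?_⟩
  have hr : (0 : ℝ) < (1 / 2) ^ n := by positivity
  have hhalf : (0 : ℝ) < 1 / 2 := by norm_num
  have hrθ : ((1 / 2 : ℝ) ^ n) ^ θ = (1 / 2) ^ (θ * n) := by
    rw [← Real.rpow_natCast, ← Real.rpow_mul hhalf.le, mul_comm]
  have hlow := hcover ((1 / 2) ^ n) ((1 / 2) ^ m) hr
    (by
      simpa using Real.rpow_le_rpow_of_exponent_ge hr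
        (pow_le_one₀ hhalf.le one_half_lt_one.le) hθ)
    (by
      rw [hrθ, ← Real.rpow_natCast _ m]
      exact Real.rpow_le_rpow_of_exponent_ge hhalf one_half_lt_one.le hmn)
    (pow_lt_one₀ hhalf.le one_half_lt_one hm.ne')
  rw [half_pow_div_half_pow, ← Real.rpow_mul zero_le_two, mul_comm _ s] at hlow
  have hresult := hcompare ((1 / 2) ^ n) (A * (1 / 2) ^ n) _ _ hr (le_mul_of_one_le_left hr.le hA)
    (hlow.trans (iInf_le _ x))
  rwa [mul_div_cancel_right₀ _ hr.ne', mul_div_right_comm] at hresult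

theorem of_dyadic (hX : HasAssouadBound X D) (hD : 0 ≤ D) (hθ : 0 < θ) (hθ1 : θ ≤ 1) (hs : 0 ≤ s)
    {A C : ℝ} (hA : 1 ≤ A) (hC : 0 < C)
    (h : ∀ (x : X) (m n : ℕ), m ≤ θ * n → ENNReal.ofReal (C * 2 ^ (s * (n - m))) ≤
      closedBallCoveringNumber ((1 / 2) ^ n / A) (Metric.closedBall x (A * (1 / 2) ^ m))) :
    IsMonotoneLowerExponent X θ s := by
  obtain ⟨K, hK, hcompare⟩ := hX.exists_ofReal_div_le
  obtain ⟨B, hB, hscales⟩ := exists_dyadic_scales hθ hθ1 hA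
  refine ⟨C / (K * (B * A) ^ D), by positivity, fun r R hr _ hR hR1 => le_iInf fun x => ?_⟩
  obtain ⟨m, n, hmn, hmR, hnr, hrn, hratio⟩ := hscales r R hr hR hR1.le
  have hlow : ENNReal.ofReal (C * 2 ^ (s * (n - m))) ≤
      closedBallCoveringNumber ((1 / 2) ^ n / A) (Metric.closedBall x R) :=
    (h x m n hmn).trans (ENat.toENNReal_le.2
      (closedBallCoveringNumber_mono (Metric.closedBall_subset_closedBall hmR)))
  have hnA : (1 / 2) ^ n / A ≤ r := (div_le_self (by positivity) hA).trans hnr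
  refine le_trans (ENNReal.ofReal_le_ofReal ?_) (hcompare _ _ _ _ (by positivity) hnA hlow)
  have hR0 : 0 < R := (Real.rpow_pos_of_pos hr θ).trans_le hR
  have hnum : (R / r) ^ s ≤ 2 ^ (s * ((n : ℝ) - m)) := by
    rw [mul_comm, Real.rpow_mul zero_le_two]
    exact Real.rpow_le_rpow (by positivity) hratio hs
  have hden : r / ((1 / 2) ^ n / A) ≤ B * A := by
    rw [div_div_eq_mul_div, div_le_iff₀ (by positivity)]
    nlinarith
  rw [div_mul_eq_mul_div]
  gcongr

theorem le_of_hasAssouadBound [Nonempty X] (hX : HasAssouadBound X D)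
    (hs : IsMonotoneLowerExponent X θ s) (hθ : 0 < θ) (hθ1 : θ ≤ 1) : s ≤ D := by
  obtain ⟨x⟩ := ‹Nonempty X›
  obtain ⟨C, hC, hlow⟩ := hs.exists_dyadic hX hθ1 le_rfl
  obtain ⟨K, hK, hup⟩ := hX
  refine le_of_eventually_mul_two_rpow_le hC (K := K) ?_
  filter_upwards [Filter.eventually_ge_atTop ⌈1 / θ⌉₊] with n hn
  have hn1 : ((1 : ℕ) : ℝ) ≤ θ * (n + 1 : ℕ) := by
    have := (div_le_iff₀' hθ).1 (Nat.ceil_le.1 hn)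
    push_cast
    linarith
  have hradius : 1 * (1 / 2 : ℝ) ^ (n + 1) ≤ (1 / 2) ^ 1 := by
    rw [one_mul]
    exact pow_le_pow_of_le_one (by norm_num) one_half_lt_one.le (Nat.le_add_left 1 n)
  have hle := (hlow x 1 (n + 1) one_pos hn1).trans (hup x _ _ (by positivity) hradius)
  rw [ENNReal.ofReal_le_ofReal_iff (by positivity), one_mul, half_pow_div_half_pow,
    ← Real.rpow_mul zero_le_two, mul_comm _ D] at hle
  simpa using hle

theorem of_codimension_le [Nonempty X] (hX : HasAssouadBound X D) {η s' : ℝ}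
    (hs : IsMonotoneLowerExponent X θ s) (hθ : 0 < θ) (hθη : θ ≤ η) (hη : η < 1)
    (h : (1 - θ) / θ * (D - s) ≤ (1 - η) / η * (D - s')) :
    IsMonotoneLowerExponent X η s' := by
  have hsD : s ≤ D := hs.le_of_hasAssouadBound hX hθ (hθη.trans hη.le)
  obtain ⟨K, hK, hcompare⟩ := hX.exists_ofReal_div_le
  obtain ⟨C, hC, hcover⟩ := hs
  refine ⟨C / K, by positivity, fun r R hr hrη hR hR1 => le_iInf fun x => ?_⟩
  have hR0 : 0 < R := (Real.rpow_pos_of_pos hr η).trans_le hR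
  have hr1 : r ≤ 1 := (hrη.trans hR).trans hR1.le
  have hscales := rpow_mul_rpow_le_of_codimension_le hθ hθη hη hsD h hr hr1 hR
  -- At the finer radius `r ^ (η / θ)`, the scales allowed for `θ` are those allowed for `η`.
  set r' := r ^ (η / θ) with hr'
  have hr'0 : 0 < r' := Real.rpow_pos_of_pos hr _
  have hr'r : r' ≤ r := by
    simpa using Real.rpow_le_rpow_of_exponent_ge hr hr1 ((one_le_div hθ).2 hθη)
  have hr'θ : r' ^ θ = r ^ η := by rw [hr', ← Real.rpow_mul hr.le, div_mul_cancel₀ _ hθ.ne']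
  have hlow := hcompare r' r _ _ hr'0 hr'r ((hcover r' R hr'0
    (hr'θ ▸ hr'r.trans hrη) (hr'θ ▸ hR) hR1).trans (iInf_le _ x))
  refine le_trans (ENNReal.ofReal_le_ofReal ?_) hlow
  rw [div_mul_eq_mul_div, div_le_div_iff₀ hK (by positivity)]
  calc C * (R / r) ^ s' * (K * (r / r') ^ D) = C * ((R / r) ^ s' * (r / r') ^ D) * K := by ring
    _ ≤ C * (R / r') ^ s * K := by gcongr

theorem ofReal_le_scaledMonotoneLowerSpectrum (hs : IsMonotoneLowerExponent X θ s) (hθ : θ < 1) :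
    ENNReal.ofReal ((1 - θ) * s) ≤ scaledMonotoneLowerSpectrum X θ := by
  rcases le_total s 0 with hs0 | hs0
  · rw [ENNReal.ofReal_of_nonpos (mul_nonpos_of_nonneg_of_nonpos (sub_pos.2 hθ).le hs0)]
    exact zero_le
  · rw [scaledMonotoneLowerSpectrum, if_neg hθ.ne, ENNReal.ofReal_mul (sub_pos.2 hθ).le]
    gcongr
    exact le_iSup₂_of_le s.toNNReal (by rwa [Real.coe_toNNReal s hs0]) le_rfl

end IsMonotoneLowerExponent

section Spectrum

variable {X : Type*} [MetricSpace X] {D θ : ℝ}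

theorem scaledMonotoneLowerSpectrum_le_ofReal_iff {v : ℝ} (hθ : θ < 1) (hv : 0 ≤ v) :
    scaledMonotoneLowerSpectrum X θ ≤ ENNReal.ofReal v ↔
      ∀ s, 0 ≤ s → IsMonotoneLowerExponent X θ s → (1 - θ) * s ≤ v := by
  refine ⟨fun h s _ hs => ?_, fun h => ?_⟩
  · exact (ENNReal.ofReal_le_ofReal_iff hv).1
      ((hs.ofReal_le_scaledMonotoneLowerSpectrum hθ).trans h)
  · rw [scaledMonotoneLowerSpectrum, if_neg hθ.ne, monotoneLowerSpectrum]
    simp only [ENNReal.mul_iSup]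
    refine iSup₂_le fun s hs => ?_
    rw [← ENNReal.ofReal_coe_nnreal, ← ENNReal.ofReal_mul (sub_pos.2 hθ).le]
    exact ENNReal.ofReal_le_ofReal (h s s.2 hs)

theorem scaledMonotoneLowerSpectrum_one : scaledMonotoneLowerSpectrum X 1 = 0 := if_pos rfl

theorem div_one_sub_le_of_scaledMonotoneLowerSpectrum_eq {a b u v : ℝ} (hab : a ≤ b)
    (hb : b < 1) (hu : 0 ≤ u)
    (hau : scaledMonotoneLowerSpectrum X a = ENNReal.ofReal u)
    (hbv : scaledMonotoneLowerSpectrum X b = ENNReal.ofReal v) : v / (1 - b) ≤ u / (1 - a) := by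
  have ha1 : 0 < 1 - a := sub_pos.2 (hab.trans_lt hb)
  have hb1 : 0 < 1 - b := sub_pos.2 hb
  have hw : 0 ≤ u / (1 - a) * (1 - b) := mul_nonneg (div_nonneg hu ha1.le) hb1.le
  rw [div_le_iff₀ hb1, ← ENNReal.ofReal_le_ofReal_iff hw, ← hbv,
    scaledMonotoneLowerSpectrum_le_ofReal_iff hb hw]
  intro s hs0 hs
  rw [mul_comm, mul_le_mul_iff_left₀ hb1, le_div_iff₀' ha1]
  exact (scaledMonotoneLowerSpectrum_le_ofReal_iff (hab.trans_lt hb) hu).1 hau.le s hs0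
    (hs.antitone hab hb.le)

variable [Nonempty X]

theorem HasAssouadBound.scaledMonotoneLowerSpectrum_le (hX : HasAssouadBound X D) (hD : 0 ≤ D)
    (hθ : 0 < θ) (hθ1 : θ < 1) :
    scaledMonotoneLowerSpectrum X θ ≤ ENNReal.ofReal (D * (1 - θ)) := by
  rw [scaledMonotoneLowerSpectrum_le_ofReal_iff hθ1 (mul_nonneg hD (sub_pos.2 hθ1).le)]
  intro s _ hs
  rw [mul_comm, mul_le_mul_iff_left₀ (sub_pos.2 hθ1)]
  exact hs.le_of_hasAssouadBound hX hθ hθ1.le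

theorem HasAssouadBound.sub_div_le_of_scaledMonotoneLowerSpectrum_eq (hX : HasAssouadBound X D)
    (hD : 0 ≤ D) {a b u v : ℝ} (ha : 0 < a) (hab : a ≤ b) (hb : b < 1) (hv : 0 ≤ v)
    (hau : scaledMonotoneLowerSpectrum X a = ENNReal.ofReal u)
    (hbv : scaledMonotoneLowerSpectrum X b = ENNReal.ofReal v) : (D - v) / b ≤ (D - u) / a := by
  have ha1 : a < 1 := hab.trans_lt hb
  have hb0 : 0 < b := ha.trans_le hab
  have hw : 0 ≤ D - (D - v) / b * a := by
    have hab' : a / b ≤ 1 := (div_le_one hb0).2 hab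
    calc 0 ≤ D * (1 - a / b) + v * (a / b) := by
          have := sub_nonneg.2 hab'
          positivity
      _ = D - (D - v) / b * a := by ring
  rw [le_div_iff₀ ha, le_sub_comm, ← ENNReal.ofReal_le_ofReal_iff hw, ← hau,
    scaledMonotoneLowerSpectrum_le_ofReal_iff ha1 hw]
  intro s _ hs
  have hcb : (1 - b) / b ≠ 0 := (div_pos (sub_pos.2 hb) hb0).ne'
  obtain ⟨s', hs'⟩ : ∃ s', (1 - a) / a * (D - s) = (1 - b) / b * (D - s') :=
    ⟨D - (1 - a) / a * (D - s) / ((1 - b) / b), by rw [sub_sub_cancel, mul_div_cancel₀ _ hcb]⟩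
  have hle : (1 - b) * s' ≤ v := by
    rw [← ENNReal.ofReal_le_ofReal_iff hv, ← hbv]
    exact (hs.of_codimension_le hX ha hab hb hs'.le).ofReal_le_scaledMonotoneLowerSpectrum hb
  have hcodim : (D - v) / b - D ≤ (1 - a) / a * (D - s) := by
    rw [hs', div_sub' hb0.ne', div_mul_eq_mul_div, div_le_div_iff_of_pos_right hb0]
    linarith
  rw [div_mul_eq_mul_div, le_div_iff₀ ha] at hcodim
  linarith

theorem HasAssouadBound.isSpectrumProfile (hX : HasAssouadBound X D) (hD : 0 ≤ D)
    {φ : ℝ → ℝ} (hφ : ∀ θ ∈ Set.Ioc (0 : ℝ) 1, 0 ≤ φ θ)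
    (h : ∀ θ ∈ Set.Ioc (0 : ℝ) 1, scaledMonotoneLowerSpectrum X θ = ENNReal.ofReal (φ θ)) :
    IsSpectrumProfile D φ := by
  have hone : φ 1 = 0 := by
    have h1 := h 1 ⟨one_pos, le_rfl⟩
    rw [scaledMonotoneLowerSpectrum_one, eq_comm, ENNReal.ofReal_eq_zero] at h1
    exact h1.antisymm (hφ 1 ⟨one_pos, le_rfl⟩)
  refine ⟨fun a ha b hb hab => ?_, hone, fun a ha b hb hab => ?_⟩
  · have ha' := Set.Ioo_subset_Ioc_self ha
    have hb' := Set.Ioo_subset_Ioc_self hb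
    exact div_one_sub_le_of_scaledMonotoneLowerSpectrum_eq hab hb.2 (hφ a ha') (h a ha') (h b hb')
  · rcases hb.2.lt_or_eq with hb1 | rfl
    · exact hX.sub_div_le_of_scaledMonotoneLowerSpectrum_eq hD ha.1 hab hb1 (hφ b hb) (h a ha)
        (h b hb)
    · have hle : φ a ≤ D * (1 - a) := by
        rcases hab.lt_or_eq with ha1 | rfl
        · rw [← ENNReal.ofReal_le_ofReal_iff (mul_nonneg hD (sub_pos.2 ha1).le), ← h a ha]
          exact hX.scaledMonotoneLowerSpectrum_le hD ha.1 ha1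
        · simp [hone]
      change (D - φ 1) / 1 ≤ (D - φ a) / a
      rw [hone, le_div_iff₀ ha.1]
      linarith

end Spectrum

/-- The number in `[0, 2)` whose binary digits `1` are at the places in `I`, where the place `p`
has weight `2 ^ (-p)`. -/
noncomputable def binarySum (I : Finset ℕ) : ℝ := ∑ p ∈ I, (1 / 2) ^ p

/-- The translate by `t` of the set of numbers with a finite binary expansion whose digits `1` are
all at places in `A`. -/
def digitSet (t : ℝ) (A : Set ℕ) : Set ℝ := {y | ∃ I : Finset ℕ, ↑I ⊆ A ∧ t + binarySum I = y}

open Classical in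
/-- The number of places of `A` in `(m, n]`. -/
noncomputable def digitCount (A : Set ℕ) (m n : ℕ) : ℕ := ((Finset.Ioc m n).filter (· ∈ A)).card

section BinaryDigits

theorem binarySum_nonneg (I : Finset ℕ) : 0 ≤ binarySum I :=
  Finset.sum_nonneg fun _ _ => by positivity

theorem binarySum_union {I J : Finset ℕ} (h : Disjoint I J) :
    binarySum (I ∪ J) = binarySum I + binarySum J :=
  Finset.sum_union h

theorem two_pow_mul_binarySum {I : Finset ℕ} {n : ℕ} (hI : ∀ p ∈ I, p ≤ n) :
    2 ^ n * binarySum I = ((∑ k ∈ I.image (n - ·), 2 ^ k : ℕ) : ℝ) := by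
  rw [Finset.sum_image fun p hp q hq hpq => by have := hI p hp; have := hI q hq; omega, binarySum,
    Finset.mul_sum]
  push_cast
  refine Finset.sum_congr rfl fun p hp => ?_
  rw [pow_sub₀ 2 two_ne_zero (hI p hp), one_div, inv_pow]

theorem binarySum_lt {I : Finset ℕ} {m : ℕ} (hI : ∀ p ∈ I, m < p) :
    binarySum I < (1 / 2) ^ m := by
  set n := max m (I.sup id)
  have hn : ∀ p ∈ I, p ≤ n := fun p hp => (Finset.le_sup (f := id) hp).trans (le_max_right _ _)
  have hmn : m ≤ n := le_max_left _ _
  have hlt : ∑ k ∈ I.image (n - ·), 2 ^ k < 2 ^ (n - m) := by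
    refine Nat.geomSum_lt le_rfl (Finset.forall_mem_image.2 fun p hp => ?_)
    have := hI p hp
    have := hn p hp
    omega
  refine lt_of_mul_lt_mul_left ?_ (pow_nonneg zero_le_two n)
  rw [two_pow_mul_binarySum hn, one_div, inv_pow, ← pow_sub₀ 2 two_ne_zero hmn]
  exact_mod_cast hlt

theorem half_pow_le_abs_binarySum_sub {I J : Finset ℕ} {n : ℕ} (hI : ∀ p ∈ I, p ≤ n)
    (hJ : ∀ p ∈ J, p ≤ n) (hIJ : I ≠ J) : (1 / 2) ^ n ≤ |binarySum I - binarySum J| := by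
  have hne : (∑ k ∈ I.image (n - ·), 2 ^ k : ℕ) ≠ ∑ k ∈ J.image (n - ·), 2 ^ k := by
    refine (Finset.geomSum_injective le_rfl).ne fun h => hIJ ?_
    have hinv : ∀ K : Finset ℕ, (∀ p ∈ K, p ≤ n) → (K.image (n - ·)).image (n - ·) = K := by
      intro K hK
      rw [Finset.image_image]
      exact (Finset.image_congr fun p hp => Nat.sub_sub_self (hK p hp)).trans Finset.image_id
    rw [← hinv I hI, ← hinv J hJ, h]
  have hone : (1 : ℝ) ≤ |2 ^ n * binarySum I - 2 ^ n * binarySum J| := by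
    rw [two_pow_mul_binarySum hI, two_pow_mul_binarySum hJ]
    exact_mod_cast Int.one_le_abs (sub_ne_zero.2 (Nat.cast_injective.ne hne))
  rwa [← mul_sub, abs_mul, abs_of_pos (by positivity), ← div_le_iff₀' (by positivity),
    ← one_div_pow] at hone

theorem binarySum_injective : Function.Injective binarySum := by
  intro I J hIJ
  by_contra hne
  have hle := half_pow_le_abs_binarySum_sub (n := (I ∪ J).sup id)
    (fun p hp => Finset.le_sup (f := id) (Finset.mem_union_left J hp))
    (fun p hp => Finset.le_sup (f := id) (Finset.mem_union_right I hp)) hne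
  rw [hIJ, sub_self, abs_zero] at hle
  exact hle.not_gt (by positivity)

theorem exists_separated_finset_digitSet {t x : ℝ} {A : Set ℕ} (hx : x ∈ digitSet t A) (m n : ℕ) :
    ∃ P : Finset ℝ, (∀ y ∈ P, y ∈ digitSet t A ∧ |y - x| ≤ (1 / 2) ^ m) ∧
      (P : Set ℝ).Pairwise (fun y z => (1 / 2) ^ n ≤ |y - z|) ∧ P.card = 2 ^ digitCount A m n := by
  classical
  obtain ⟨I, hI, rfl⟩ := hx
  set W := (Finset.Ioc m n).filter (· ∈ A) with hW
  set f : Finset ℕ → ℝ := fun J => t + (binarySum (I \ Finset.Ioc m n) + binarySum J) with hf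
  have hmem : ∀ J ⊆ W, ∀ p ∈ J, (m < p ∧ p ≤ n) ∧ p ∈ A := by
    intro J hJ p hp
    simpa [hW] using hJ hp
  refine ⟨W.powerset.image f, Finset.forall_mem_image.2 fun J hJ => ?_, ?_, ?_⟩
  · rw [Finset.mem_powerset] at hJ
    have hdisj : Disjoint (I \ Finset.Ioc m n) J :=
      Finset.disjoint_of_subset_right (hJ.trans (Finset.filter_subset _ _)) Finset.sdiff_disjoint
    refine ⟨⟨I \ Finset.Ioc m n ∪ J, ?_, by rw [binarySum_union hdisj]⟩, ?_⟩
    · rw [Finset.coe_union, Finset.coe_sdiff]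
      exact Set.union_subset (Set.sdiff_subset.trans hI) fun p hp => (hmem J hJ p hp).2
    · have hsplit : binarySum I = binarySum (I \ Finset.Ioc m n) +
          binarySum (I ∩ Finset.Ioc m n) := by
        rw [← binarySum_union (Finset.disjoint_sdiff_inter _ _), Finset.sdiff_union_inter]
      simp only [hf, hsplit, add_sub_add_left_eq_sub]
      refine (abs_sub_lt_of_nonneg_of_lt (binarySum_nonneg _)
        (binarySum_lt fun p hp => (hmem J hJ p hp).1.1) (binarySum_nonneg _)
        (binarySum_lt fun p hp => ?_)).le
      exact (Finset.mem_Ioc.1 (Finset.mem_inter.1 hp).2).1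
  · rw [Finset.coe_image]
    rintro _ ⟨J, hJ, rfl⟩ _ ⟨K, hK, rfl⟩ hne
    simp only [hf, add_sub_add_left_eq_sub]
    exact half_pow_le_abs_binarySum_sub (fun p hp => (hmem J (Finset.mem_powerset.1 hJ) p hp).1.2)
      (fun p hp => (hmem K (Finset.mem_powerset.1 hK) p hp).1.2) fun h => hne (h ▸ rfl)
  · have hf_inj : f.Injective := fun J K h =>
      binarySum_injective (add_left_cancel (add_left_cancel h))
    rw [Finset.card_image_of_injective _ hf_inj, Finset.card_powerset, digitCount]

theorem self_mem_digitSet (t : ℝ) (A : Set ℕ) : t ∈ digitSet t A :=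
  ⟨∅, by simp, by simp [binarySum]⟩

theorem mem_Ico_of_mem_digitSet {t y : ℝ} {A : Set ℕ} {m : ℕ} (hA : A ⊆ Set.Ioi m)
    (hy : y ∈ digitSet t A) : y ∈ Set.Ico t (t + (1 / 2) ^ m) := by
  obtain ⟨I, hI, rfl⟩ := hy
  exact ⟨le_add_of_nonneg_right (binarySum_nonneg I),
    add_lt_add_right (binarySum_lt fun p hp => hA (hI hp)) t⟩

theorem exists_finset_cover_digitSet (t : ℝ) {A : Set ℕ} {m : ℕ} (hA : A ⊆ Set.Ioi m) (n : ℕ) :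
    ∃ Q : Finset ℝ, Q.card ≤ 2 ^ digitCount A m n ∧ ↑Q ⊆ digitSet t A ∧
      ∀ y ∈ digitSet t A, ∃ z ∈ Q, |y - z| ≤ (1 / 2) ^ n := by
  classical
  set W := (Finset.Ioc m n).filter (· ∈ A)
  refine ⟨W.powerset.image (t + binarySum ·), ?_, ?_, ?_⟩
  · exact Finset.card_image_le.trans_eq (by rw [Finset.card_powerset, digitCount])
  · rw [Finset.coe_image]
    rintro _ ⟨J, hJ, rfl⟩
    exact ⟨J, fun p hp => (Finset.mem_filter.1 (Finset.mem_powerset.1 hJ hp)).2, rfl⟩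
  · rintro _ ⟨I, hI, rfl⟩
    refine ⟨_, Finset.mem_image_of_mem _ (Finset.mem_powerset.2 (?_ : I.filter (· ≤ n) ⊆ W)), ?_⟩
    · intro p hp
      obtain ⟨hpI, hpn⟩ := Finset.mem_filter.1 hp
      exact Finset.mem_filter.2 ⟨Finset.mem_Ioc.2 ⟨hA (hI hpI), hpn⟩, hI hpI⟩
    · have hsplit : binarySum I = binarySum (I.filter (· ≤ n)) +
          binarySum (I.filter (¬ · ≤ n)) :=
        (Finset.sum_filter_add_sum_filter_not I _ _).symm
      rw [hsplit, add_sub_add_left_eq_sub, add_sub_cancel_left, abs_of_nonneg (binarySum_nonneg _)]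
      exact (binarySum_lt fun p hp => not_le.1 (Finset.mem_filter.1 hp).2).le

theorem digitCount_succ (A : Set ℕ) [DecidablePred (· ∈ A)] {m n : ℕ} (h : m ≤ n) :
    digitCount A m (n + 1) = digitCount A m n + if n + 1 ∈ A then 1 else 0 := by
  rw [digitCount, digitCount, ← Finset.insert_Ioc_right_eq_Ioc_add_one h, Finset.filter_insert]
  split_ifs <;> simp

theorem digitCount_of_Ioc_subset {A : Set ℕ} {m n : ℕ} (h : Set.Ioc m n ⊆ A) :
    digitCount A m n = n - m := by
  classical
  rw [digitCount, Finset.filter_true_of_mem fun p hp => h (Finset.mem_Ioc.1 hp), Nat.card_Ioc]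

/-- The places where the integer part of the counting function `g` jumps: if `g` is monotone with
steps at most `1`, the interval `(m, n]` contains `g n - g m` of them up to an error of `1`. -/
def jumpSet (g : ℕ → ℝ) : Set ℕ := {p | ⌊g (p - 1)⌋ < ⌊g p⌋}

theorem floor_add_digitCount_jumpSet {g : ℕ → ℝ} (hg : Monotone g) (hg1 : ∀ n, g (n + 1) ≤ g n + 1)
    {m n : ℕ} (h : m ≤ n) : ⌊g m⌋ + digitCount (jumpSet g) m n = ⌊g n⌋ := by
  classical
  induction n, h using Nat.le_induction with
  | base => simp [digitCount]
  | succ n hmn ih =>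
    have hle : ⌊g n⌋ ≤ ⌊g (n + 1)⌋ := Int.floor_mono (hg n.le_succ)
    have hle1 : ⌊g (n + 1)⌋ ≤ ⌊g n⌋ + 1 := by
      rw [← Int.floor_add_one]
      exact Int.floor_mono (hg1 n)
    have hmem : n + 1 ∈ jumpSet g ↔ ⌊g n⌋ < ⌊g (n + 1)⌋ := Iff.rfl
    rw [digitCount_succ _ hmn, Nat.cast_add, ← add_assoc, ih, hmem]
    split_ifs <;> push_cast <;> omega

theorem abs_digitCount_jumpSet_sub_le {g : ℕ → ℝ} (hg : Monotone g)
    (hg1 : ∀ n, g (n + 1) ≤ g n + 1) {m n : ℕ} (h : m ≤ n) :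
    |digitCount (jumpSet g) m n - (g n - g m)| ≤ 1 := by
  have hfloor : (⌊g m⌋ : ℝ) + digitCount (jumpSet g) m n = ⌊g n⌋ := by
    exact_mod_cast floor_add_digitCount_jumpSet hg hg1 h
  have hm := Int.floor_le (g m)
  have hm' := Int.lt_floor_add_one (g m)
  have hn := Int.floor_le (g n)
  have hn' := Int.lt_floor_add_one (g n)
  rw [abs_le]
  constructor <;> linarith

end BinaryDigits

/-- The function `δ` with `ψ θ = (1 - θ) * (1 - δ θ)`: where `ψ` is `(1 - θ)` times a dimension of a
subset of the line, it is the codimension. -/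
noncomputable def codim (ψ : ℝ → ℝ) (θ : ℝ) : ℝ := 1 - ψ θ / (1 - θ)

theorem one_sub_mul_one_sub_codim {ψ : ℝ → ℝ} {θ : ℝ} (hθ : θ ≠ 1) :
    (1 - θ) * (1 - codim ψ θ) = ψ θ := by
  rw [codim, sub_sub_cancel, mul_div_cancel₀ _ (sub_ne_zero.2 hθ.symm)]

theorem div_mem_Ioo {a b : ℝ} (ha : 0 < a) (hab : a < b) : a / b ∈ Set.Ioo (0 : ℝ) 1 :=
  ⟨div_pos ha (ha.trans hab), (div_lt_one (ha.trans hab)).2 hab⟩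

namespace IsSpectrumProfile

variable {ψ : ℝ → ℝ} {θ : ℝ}

theorem monotoneOn_codim (h : IsSpectrumProfile 1 ψ) : MonotoneOn (codim ψ) (Set.Ioo 0 1) :=
  fun _ ha _ hb hab => sub_le_sub_left (h.antitoneOn_div_one_sub ha hb hab) 1

theorem antitoneOn_mul_codim (h : IsSpectrumProfile 1 ψ) :
    AntitoneOn (fun θ => (1 / θ - 1) * codim ψ θ) (Set.Ioo 0 1) := by
  refine (h.antitoneOn_sub_div.mono Set.Ioo_subset_Ioc_self |>.add_const (-1)).congr fun θ hθ => ?_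
  have h0 : θ ≠ 0 := hθ.1.ne'
  have h1 : 1 - θ ≠ 0 := (sub_pos.2 hθ.2).ne'
  simp only [codim]
  field_simp
  ring

theorem codim_nonneg (h : IsSpectrumProfile 1 ψ) (hθ : θ ∈ Set.Ioo (0 : ℝ) 1) : 0 ≤ codim ψ θ := by
  have hle := h.le_mul_one_sub ⟨hθ.1, hθ.2.le⟩
  rw [← div_le_iff₀ (sub_pos.2 hθ.2)] at hle
  exact sub_nonneg.2 hle

theorem codim_mem_Icc (h : IsSpectrumProfile 1 ψ) (hψ : 0 ≤ ψ θ) (hθ : θ ∈ Set.Ioo (0 : ℝ) 1) :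
    codim ψ θ ∈ Set.Icc (0 : ℝ) 1 :=
  ⟨h.codim_nonneg hθ, sub_le_self 1 (div_nonneg hψ (sub_nonneg.2 hθ.2.le))⟩

theorem codim_mul_min_sub_min_le (h : IsSpectrumProfile 1 ψ) (hθ : θ ∈ Set.Ioo (0 : ℝ) 1)
    {a b m n : ℝ} (ha : 0 < a) (hab : a < b) (ham : a ≤ m) (hmn : m ≤ θ * n) :
    codim ψ (a / b) * (min n b - min m b) ≤ codim ψ θ * (n - m) := by
  have hq : a / b ∈ Set.Ioo (0 : ℝ) 1 := div_mem_Ioo ha hab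
  have hδ := h.codim_nonneg hθ
  have hδq := h.codim_nonneg hq
  have hn : m * (1 / θ - 1) ≤ n - m := by
    have : m / θ ≤ n := (div_le_iff₀' hθ.1).2 hmn
    linear_combination this
  have hmn' : m ≤ n := by
    have : 0 ≤ 1 / θ - 1 := sub_nonneg.2 (one_le_one_div hθ.1 hθ.2.le)
    nlinarith
  rcases le_total b m with hbm | hmb
  · rw [min_eq_right hbm, min_eq_right (hbm.trans hmn'), sub_self, mul_zero]
    exact mul_nonneg hδ (sub_nonneg.2 hmn')
  rw [min_eq_left hmb]
  rcases le_total (a / b) θ with hle | hle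
  · exact mul_le_mul (h.monotoneOn_codim hq hθ hle) (sub_le_sub_right (min_le_left n b) m)
      (sub_nonneg.2 (le_min hmn' hmb)) hδ
  · calc codim ψ (a / b) * (min n b - m)
        ≤ codim ψ (a / b) * (m * (1 / (a / b) - 1)) := by
          refine mul_le_mul_of_nonneg_left ?_ hδq
          have hb : b ≤ m * (1 / (a / b)) := by
            rw [one_div_div, ← mul_div_assoc, le_div_iff₀ ha, mul_comm b]
            exact mul_le_mul_of_nonneg_right ham (ha.trans hab).le
          linear_combination min_le_right n b + hb
      _ = m * ((1 / (a / b) - 1) * codim ψ (a / b)) := by ring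
      _ ≤ m * ((1 / θ - 1) * codim ψ θ) :=
          mul_le_mul_of_nonneg_left (h.antitoneOn_mul_codim hθ hq hle) (ha.le.trans ham)
      _ ≤ codim ψ θ * (n - m) := by
          linear_combination codim ψ θ * hn

end IsSpectrumProfile

/-- A counting function that is constant up to `a`, grows with slope `1 - δ` between `a` and `b`,
and grows with slope `1` beyond `b`. -/
noncomputable def thinnedCount (a b : ℕ) (δ : ℝ) (p : ℕ) : ℝ :=
  max (p : ℝ) a - δ * min (max (p : ℝ) a) b

section ThinnedCount

variable {a b : ℕ} {δ : ℝ}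

theorem thinnedCount_of_le {p : ℕ} (h : a ≤ p) :
    thinnedCount a b δ p = p - δ * min (p : ℝ) b := by
  rw [thinnedCount, max_eq_left (Nat.cast_le.2 h)]

theorem monotone_thinnedCount (hδ : δ ≤ 1) : Monotone (thinnedCount a b δ) := by
  intro p q hpq
  have hmax : max (p : ℝ) a ≤ max (q : ℝ) a := max_le_max_right _ (Nat.cast_le.2 hpq)
  have hmin : min (max (q : ℝ) a) b ≤ min (max (p : ℝ) a) b + (max (q : ℝ) a - max (p : ℝ) a) := by
    rw [min_add]
    exact min_le_min (by linarith) (by linarith)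
  have hmin' : min (max (p : ℝ) a) b ≤ min (max (q : ℝ) a) b := min_le_min_right _ hmax
  simp only [thinnedCount]
  nlinarith

theorem thinnedCount_succ_le (hδ : 0 ≤ δ) (p : ℕ) :
    thinnedCount a b δ (p + 1) ≤ thinnedCount a b δ p + 1 := by
  have hmax : max ((p + 1 : ℕ) : ℝ) a ≤ max (p : ℝ) a + 1 := by
    push_cast
    exact max_le (add_le_add_left (le_max_left _ _) 1)
      ((le_max_right _ _).trans (le_add_of_nonneg_right zero_le_one))
  have hmin : min (max (p : ℝ) a) b ≤ min (max ((p + 1 : ℕ) : ℝ) a) b :=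
    min_le_min_right _ (max_le_max_right _ (Nat.cast_le.2 p.le_succ))
  simp only [thinnedCount]
  linarith [mul_le_mul_of_nonneg_left hmin hδ]

theorem jumpSet_thinnedCount_subset : jumpSet (thinnedCount a b δ) ⊆ Set.Ioi a := by
  intro p hp
  by_contra! hle
  have hpa : (p : ℝ) ≤ a := Nat.cast_le.2 (Set.notMem_Ioi.1 hle)
  have hpa' : ((p - 1 : ℕ) : ℝ) ≤ a := Nat.cast_le.2 ((p.sub_le 1).trans (Set.notMem_Ioi.1 hle))
  refine (lt_irrefl _ (?_ : ⌊thinnedCount a b δ p⌋ < ⌊thinnedCount a b δ p⌋))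
  simpa only [jumpSet, Set.mem_ofPred_eq, thinnedCount, max_eq_right hpa, max_eq_right hpa']
    using hp

theorem abs_digitCount_thinnedCount_sub_le (hδ : δ ∈ Set.Icc (0 : ℝ) 1) {m n : ℕ} (ham : a ≤ m)
    (hmn : m ≤ n) :
    |digitCount (jumpSet (thinnedCount a b δ)) m n -
      (n - m - δ * (min (n : ℝ) b - min (m : ℝ) b))| ≤ 1 := by
  have h := abs_digitCount_jumpSet_sub_le (monotone_thinnedCount (a := a) (b := b) hδ.2)
    (thinnedCount_succ_le hδ.1) hmn
  rw [thinnedCount_of_le ham, thinnedCount_of_le (ham.trans hmn)] at h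
  convert h using 3
  ring

end ThinnedCount

/-- The origin of the copy of the dyadic rationals of `[0, 1)` indexed by `(a, b)`; distinct copies
are at distance at least `2`. -/
def copyOrigin (a b : ℕ) : ℝ := 3 * Nat.pair a b

/-- The leftmost point of the thinned piece indexed by `(a, b)`. -/
noncomputable def thinnedOrigin (a b : ℕ) : ℝ := copyOrigin a b - 2 * (1 / 2) ^ a

/-- A set of diameter at most `2 ^ (-a)` that has codimension `δ` at the scales between `2 ^ (-b)`
and `2 ^ (-a)`, and is full-dimensional below scale `2 ^ (-b)`. -/
noncomputable def thinnedPiece (a b : ℕ) (δ : ℝ) : Set ℝ :=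
  digitSet (thinnedOrigin a b) (jumpSet (thinnedCount a b δ))

/-- For all `0 < a < b`, a copy of the dyadic rationals of `[0, 1)` and, at distance comparable to
`2 ^ (-a)` from it, the piece thinned to codimension `δ (a / b)`. At scales above `2 ^ (-a)` the
piece merges into the copy, so that it only lowers the spectrum through smaller scales. -/
def thinnedLine (δ : ℝ → ℝ) : Set ℝ :=
  {y | ∃ a b : ℕ, 0 < a ∧ a < b ∧
    (y ∈ digitSet (copyOrigin a b) (Set.Ioi 0) ∨ y ∈ thinnedPiece a b (δ (a / b)))}

section ThinnedLine

theorem mem_Ico_of_mem_thinnedPiece {a b : ℕ} {δ y : ℝ} (hy : y ∈ thinnedPiece a b δ) :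
    y ∈ Set.Ico (copyOrigin a b - 2 * (1 / 2) ^ a) (copyOrigin a b - (1 / 2) ^ a) := by
  have h := mem_Ico_of_mem_digitSet jumpSet_thinnedCount_subset hy
  rw [thinnedOrigin] at h
  exact ⟨h.1, h.2.trans_eq (by ring)⟩

theorem mem_thinnedPiece_of_abs_sub_le {δ : ℝ → ℝ} {a b : ℕ} (ha : 0 < a) {y : ℝ}
    (hy : y ∈ thinnedLine δ) (h : |y - thinnedOrigin a b| ≤ (1 / 2) ^ a) :
    y ∈ thinnedPiece a b (δ (a / b)) := by
  have half : ∀ {c : ℕ}, 0 < c → (0 : ℝ) < (1 / 2) ^ c ∧ (1 / 2 : ℝ) ^ c ≤ 1 / 2 := fun hc =>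
    ⟨by positivity, pow_le_of_le_one (by norm_num) (by norm_num) hc.ne'⟩
  obtain ⟨a', b', ha', -, hy⟩ := hy
  obtain ⟨hpos, hhalf⟩ := half ha
  rw [thinnedOrigin, abs_le] at h
  have hrange : copyOrigin a' b' - 1 ≤ y ∧ y < copyOrigin a' b' + 1 := by
    rcases hy with hy | hy
    · have hy' := mem_Ico_of_mem_digitSet subset_rfl hy
      rw [pow_zero] at hy'
      exact ⟨by linarith [hy'.1], hy'.2⟩
    · have hy' := mem_Ico_of_mem_thinnedPiece hy
      obtain ⟨hpos', hhalf'⟩ := half ha'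
      constructor <;> linarith [hy'.1, hy'.2]
  have hpair : Nat.pair a' b' = Nat.pair a b := by
    simp only [copyOrigin] at h hrange
    have hlt : (Nat.pair a' b' : ℝ) < Nat.pair a b + 1 := by linarith
    have hgt : (Nat.pair a b : ℝ) < Nat.pair a' b' + 1 := by linarith
    norm_cast at hlt hgt
    omega
  obtain ⟨rfl, rfl⟩ := Nat.pair_eq_pair.1 hpair
  refine hy.resolve_left fun hy => ?_
  linarith [(mem_Ico_of_mem_digitSet subset_rfl hy).1]

theorem exists_digitSet_subset_thinnedLine {ψ : ℝ → ℝ} (h : IsSpectrumProfile 1 ψ)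
    (hψ : ∀ θ ∈ Set.Ioc (0 : ℝ) 1, 0 ≤ ψ θ) {θ : ℝ} (hθ : θ ∈ Set.Ioo (0 : ℝ) 1) {x : ℝ}
    (hx : x ∈ thinnedLine (codim ψ)) {m n : ℕ} (hmn : (m : ℝ) ≤ θ * n) :
    ∃ (t : ℝ) (A : Set ℕ), digitSet t A ⊆ thinnedLine (codim ψ) ∧
      (∃ y ∈ digitSet t A, |y - x| ≤ (1 / 2) ^ m) ∧
      (1 - codim ψ θ) * (n - m) ≤ digitCount A m n + 1 := by
  obtain ⟨a, b, ha, hab, hx⟩ := hx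
  have hmn' : m ≤ n := by
    have : (m : ℝ) ≤ n := hmn.trans (mul_le_of_le_one_left n.cast_nonneg hθ.2.le)
    exact_mod_cast this
  have hself : |x - x| ≤ (1 / 2 : ℝ) ^ m := by
    rw [sub_self, abs_zero]
    positivity
  have hcopy : digitSet (copyOrigin a b) (Set.Ioi 0) ⊆ thinnedLine (codim ψ) :=
    fun y hy => ⟨a, b, ha, hab, .inl hy⟩
  have hcopy_count : (1 - codim ψ θ) * (n - m) ≤ digitCount (Set.Ioi 0) m n + 1 := by
    rw [digitCount_of_Ioc_subset fun p hp => Set.mem_Ioi.2 (pos_of_gt hp.1), Nat.cast_sub hmn']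
    linarith [mul_nonneg (h.codim_nonneg hθ) (sub_nonneg.2 (Nat.cast_le (α := ℝ).2 hmn'))]
  rcases hx with hx | hx
  · exact ⟨_, _, hcopy, ⟨x, hx, hself⟩, hcopy_count⟩
  rcases le_or_gt a m with ham | hma
  · refine ⟨_, _, fun y hy => ⟨a, b, ha, hab, .inr hy⟩, ⟨x, hx, hself⟩, ?_⟩
    have ha' : (0 : ℝ) < a := Nat.cast_pos.2 ha
    have hab' : (a : ℝ) < b := Nat.cast_lt.2 hab
    have hq : (a : ℝ) / b ∈ Set.Ioo (0 : ℝ) 1 := div_mem_Ioo ha' hab'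
    have hcount := abs_digitCount_thinnedCount_sub_le (b := b)
      (h.codim_mem_Icc (hψ _ ⟨hq.1, hq.2.le⟩) hq) ham hmn'
    have hcodim := h.codim_mul_min_sub_min_le hθ ha' hab' (Nat.cast_le.2 ham) hmn
    linarith [(abs_le.1 hcount).1]
  · refine ⟨_, _, hcopy, ⟨copyOrigin a b, self_mem_digitSet _ _, ?_⟩, hcopy_count⟩
    have hscale : 2 * (1 / 2 : ℝ) ^ a ≤ (1 / 2) ^ m := by
      have := pow_le_pow_of_le_one (by norm_num : (0 : ℝ) ≤ 1 / 2) (by norm_num) hma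
      rw [Nat.succ_eq_add_one, pow_succ] at this
      linarith
    have hx' := mem_Ico_of_mem_thinnedPiece hx
    rw [abs_of_pos] <;> linarith [hx'.1, hx'.2, (by positivity : (0 : ℝ) < (1 / 2) ^ a)]

theorem exists_separated_finset_thinnedLine {ψ : ℝ → ℝ} (h : IsSpectrumProfile 1 ψ)
    (hψ : ∀ θ ∈ Set.Ioc (0 : ℝ) 1, 0 ≤ ψ θ) {θ : ℝ} (hθ : θ ∈ Set.Ioo (0 : ℝ) 1) {x : ℝ}
    (hx : x ∈ thinnedLine (codim ψ)) {m n : ℕ} (hmn : (m : ℝ) ≤ θ * n) :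
    ∃ P : Finset ℝ,
      (∀ y ∈ P, y ∈ thinnedLine (codim ψ) ∧ |y - x| ≤ 2 * (1 / 2) ^ m) ∧
      (P : Set ℝ).Pairwise (fun y z => (1 / 2) ^ n ≤ |y - z|) ∧
      (2 : ℝ) ^ ((1 - codim ψ θ) * (n - m) - 1) ≤ P.card := by
  obtain ⟨t, A, hA, ⟨u, hu, hux⟩, hcount⟩ := exists_digitSet_subset_thinnedLine h hψ hθ hx hmn
  obtain ⟨P, hP, hsep, hcard⟩ := exists_separated_finset_digitSet hu m n
  refine ⟨P, fun y hy => ⟨hA (hP y hy).1, ?_⟩, hsep, ?_⟩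
  · linarith [abs_sub_le y u x, (hP y hy).2]
  · rw [hcard, Nat.cast_pow, Nat.cast_ofNat, ← Real.rpow_natCast]
    exact Real.rpow_le_rpow_of_exponent_le one_le_two (sub_le_iff_le_add.2 hcount)

theorem exists_finset_cover_thinnedLine {ψ : ℝ → ℝ} (h : IsSpectrumProfile 1 ψ)
    (hψ : ∀ θ ∈ Set.Ioc (0 : ℝ) 1, 0 ≤ ψ θ) {a b : ℕ} (ha : 0 < a) (hab : a < b) :
    ∃ x ∈ thinnedLine (codim ψ), ∃ Q : Finset ℝ,
      (Q.card : ℝ) ≤ 2 ^ (ψ (a / b) * b + 1) ∧ ↑Q ⊆ thinnedLine (codim ψ) ∧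
      ∀ y ∈ thinnedLine (codim ψ), |y - x| ≤ (1 / 2) ^ a → ∃ z ∈ Q, |y - z| ≤ (1 / 2) ^ b := by
  have ha' : (0 : ℝ) < a := Nat.cast_pos.2 ha
  have hab' : (a : ℝ) < b := Nat.cast_lt.2 hab
  have hb' : (0 : ℝ) < b := ha'.trans hab'
  have hq : (a : ℝ) / b ∈ Set.Ioo (0 : ℝ) 1 := div_mem_Ioo ha' hab'
  obtain ⟨Q, hcard, hQ, hcover⟩ := exists_finset_cover_digitSet (thinnedOrigin a b)
    (jumpSet_thinnedCount_subset (a := a) (b := b) (δ := codim ψ (a / b))) b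
  have hpiece : thinnedPiece a b (codim ψ (a / b)) ⊆ thinnedLine (codim ψ) :=
    fun y hy => ⟨a, b, ha, hab, .inr hy⟩
  refine ⟨thinnedOrigin a b, hpiece (self_mem_digitSet _ _), Q, ?_, hQ.trans hpiece,
    fun y hy hyx => hcover y (mem_thinnedPiece_of_abs_sub_le ha hy hyx)⟩
  have hcount := (abs_le.1 (abs_digitCount_thinnedCount_sub_le (a := a) (b := b)
    (h.codim_mem_Icc (hψ _ ⟨hq.1, hq.2.le⟩) hq)
    le_rfl hab.le)).2
  rw [min_self, min_eq_left hab'.le] at hcount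
  have hcodim : (1 - codim ψ (a / b)) * (b - a) = ψ (a / b) * b := by
    rw [← one_sub_mul_one_sub_codim (ψ := ψ) hq.2.ne]
    field_simp
  calc (Q.card : ℝ)
      ≤ (2 : ℝ) ^ (digitCount (jumpSet (thinnedCount a b (codim ψ (a / b)))) a b : ℝ) := by
        rw [Real.rpow_natCast]
        exact_mod_cast hcard
    _ ≤ 2 ^ (ψ (a / b) * b + 1) :=
        Real.rpow_le_rpow_of_exponent_le one_le_two (by linarith)

theorem thinnedLine_nonempty (δ : ℝ → ℝ) : (thinnedLine δ).Nonempty :=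
  ⟨copyOrigin 1 2, 1, 2, one_pos, one_lt_two, .inl (self_mem_digitSet _ _)⟩

end ThinnedLine

/-- The points of Euclidean space with all coordinates in `S`. -/
def coordinateSet (ι : Type*) (S : Set ℝ) : Set (EuclideanSpace ℝ ι) := {x | ∀ i, x i ∈ S}

theorem coordinateSet_nonempty (ι : Type*) {S : Set ℝ} (hS : S.Nonempty) :
    (coordinateSet ι S).Nonempty :=
  ⟨WithLp.toLp 2 fun _ => hS.some, fun _ => hS.some_mem⟩

section CoordinateSet

variable {ι : Type*} [Fintype ι] {S : Set ℝ}

theorem dist_le_sqrt_card_mul {x y : EuclideanSpace ℝ ι} {c : ℝ} (hc : 0 ≤ c)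
    (h : ∀ i, |x i - y i| ≤ c) : dist x y ≤ √(Fintype.card ι) * c := by
  rw [EuclideanSpace.dist_eq]
  refine Real.sqrt_le_iff.2 ⟨by positivity, ?_⟩
  calc ∑ i, dist (x i) (y i) ^ 2 ≤ ∑ _i : ι, c ^ 2 :=
        Finset.sum_le_sum fun i _ => pow_le_pow_left₀ dist_nonneg (h i) 2
    _ = (√(Fintype.card ι) * c) ^ 2 := by
        rw [mul_pow, Real.sq_sqrt (Nat.cast_nonneg _)]
        simp

theorem abs_sub_apply_le_dist (x y : EuclideanSpace ℝ ι) (i : ι) : |x i - y i| ≤ dist x y := by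
  rw [dist_eq_norm, ← Real.norm_eq_abs]
  exact PiLp.norm_apply_le (x - y) i

theorem ofReal_prod_card_le_closedBallCoveringNumber {x : coordinateSet ι S} {r R ε δ : ℝ}
    (hr : 0 ≤ r) (hε : 2 * r < ε) (hδ : 0 ≤ δ) (hδR : √(Fintype.card ι) * δ ≤ R)
    {P : ι → Finset ℝ} (hP : ∀ i, ∀ y ∈ P i, y ∈ S ∧ |y - x.1 i| ≤ δ)
    (hsep : ∀ i, (P i : Set ℝ).Pairwise fun y z => ε ≤ |y - z|) :
    ENNReal.ofReal (∏ i, ((P i).card : ℝ)) ≤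
      closedBallCoveringNumber r (Metric.closedBall x R) := by
  classical
  rw [ofReal_le_closedBallCoveringNumber_iff hr]
  intro T hT
  have hnear : ∀ p ∈ Fintype.piFinset P, ∃ y ∈ T, dist (WithLp.toLp 2 p) y.1 ≤ r := by
    intro p hp
    have hpi := fun i => hP i (p i) (Fintype.mem_piFinset.1 hp i)
    exact hT ⟨WithLp.toLp 2 p, fun i => (hpi i).1⟩
      ((dist_le_sqrt_card_mul hδ fun i => (hpi i).2).trans hδR)
  have : Nonempty (coordinateSet ι S) := ⟨x⟩
  choose! f hfT hfr using hnear
  rw [← Nat.cast_prod, ← Fintype.card_piFinset, Nat.cast_le]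
  refine Finset.card_le_card_of_injOn f hfT fun p hp q hq hpq => funext fun i => ?_
  by_contra hne
  have hpq_sep : ε ≤ |p i - q i| :=
    hsep i (Fintype.mem_piFinset.1 hp i) (Fintype.mem_piFinset.1 hq i) hne
  have hpq_near : |p i - q i| ≤ r + r :=
    (abs_sub_apply_le_dist (WithLp.toLp 2 p) (WithLp.toLp 2 q) i).trans <|
      (dist_triangle_right _ _ _).trans (add_le_add (hfr p hp) (hpq ▸ hfr q hq))
  linarith

theorem closedBallCoveringNumber_le_ofReal_prod_card {x : coordinateSet ι S} {r R δ : ℝ}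
    (hδ : 0 ≤ δ) (hδr : √(Fintype.card ι) * δ ≤ r) {Q : ι → Finset ℝ} (hQ : ∀ i, ↑(Q i) ⊆ S)
    (hcover : ∀ i, ∀ y ∈ S, |y - x.1 i| ≤ R → ∃ z ∈ Q i, |y - z| ≤ δ) :
    (closedBallCoveringNumber r (Metric.closedBall x R) : ℝ≥0∞) ≤
      ENNReal.ofReal (∏ i, ((Q i).card : ℝ)) := by
  classical
  have hr : 0 ≤ r := (by positivity : 0 ≤ √(Fintype.card ι) * δ).trans hδr
  rw [closedBallCoveringNumber_le_ofReal_iff hr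
    (Finset.prod_nonneg fun i _ => (Q i).card.cast_nonneg)]
  let toPoint (p : Fintype.piFinset Q) : coordinateSet ι S :=
    ⟨WithLp.toLp 2 p.1, fun i => hQ i (Fintype.mem_piFinset.1 p.2 i)⟩
  refine ⟨Finset.univ.image toPoint, ?_, fun z hz => ?_⟩
  · rw [← Nat.cast_prod, ← Fintype.card_piFinset, ← Fintype.card_coe (Fintype.piFinset Q),
      Nat.cast_le]
    exact Finset.card_image_le
  · choose q hqQ hzq using fun i => hcover i (z.1 i) (z.2 i)
      ((abs_sub_apply_le_dist z.1 x.1 i).trans hz)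
    exact ⟨toPoint ⟨q, Fintype.mem_piFinset.2 hqQ⟩,
      Finset.mem_image_of_mem _ (Finset.mem_univ _), (dist_le_sqrt_card_mul hδ hzq).trans hδr⟩

end CoordinateSet

section Realisation

variable {ι : Type*} [Fintype ι] {ψ : ℝ → ℝ} {θ : ℝ}

theorem hasAssouadBound_coordinateSet (S : Set ℝ) :
    HasAssouadBound (coordinateSet ι S) (Fintype.card ι) := by
  simpa using hasAssouadBound_subtype (coordinateSet ι S)

theorem isMonotoneLowerExponent_coordinateSet_thinnedLine (h : IsSpectrumProfile 1 ψ)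
    (hψ : ∀ θ ∈ Set.Ioc (0 : ℝ) 1, 0 ≤ ψ θ) (hθ : θ ∈ Set.Ioo (0 : ℝ) 1) :
    IsMonotoneLowerExponent (coordinateSet ι (thinnedLine (codim ψ))) θ
      (Fintype.card ι * (1 - codim ψ θ)) := by
  set D := Fintype.card ι
  set σ := 1 - codim ψ θ
  have hσ : 0 ≤ σ := sub_nonneg.2 (h.codim_mem_Icc (hψ θ ⟨hθ.1, hθ.2.le⟩) hθ).2
  have hD : 0 ≤ √D := Real.sqrt_nonneg D
  refine .of_dyadic (hasAssouadBound_coordinateSet _) D.cast_nonneg hθ.1 hθ.2.le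
    (by positivity) (A := 2 * √D + 3) (by linarith) (C := (2 ^ D)⁻¹) (by positivity)
    fun x m n hmn => ?_
  choose P hP hsep hcard using fun i =>
    exists_separated_finset_thinnedLine h hψ hθ (x.2 i) hmn
  have hprod : (2 ^ D : ℝ)⁻¹ * 2 ^ (D * σ * (n - m)) ≤ ∏ i, ((P i).card : ℝ) := by
    calc (2 ^ D : ℝ)⁻¹ * 2 ^ (D * σ * (n - m))
        = ((2 : ℝ) ^ (σ * (n - m) - 1)) ^ D := by
          rw [Real.rpow_sub_one two_ne_zero, div_pow, ← Real.rpow_mul_natCast zero_le_two]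
          ring_nf
      _ = ∏ _i : ι, (2 : ℝ) ^ (σ * (n - m) - 1) := by rw [Finset.prod_const, Finset.card_univ]
      _ ≤ ∏ i, ((P i).card : ℝ) :=
          Finset.prod_le_prod (fun _ _ => by positivity) fun i _ => hcard i
  refine (ENNReal.ofReal_le_ofReal hprod).trans
    (ofReal_prod_card_le_closedBallCoveringNumber (by positivity) ?_ (by positivity) ?_ hP hsep)
  · rw [mul_div_assoc', div_lt_iff₀ (by positivity), mul_comm]
    exact mul_lt_mul_of_pos_left (by linarith) (by positivity)
  · rw [← mul_assoc]
    exact mul_le_mul_of_nonneg_right (by linarith) (by positivity)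

theorem IsMonotoneLowerExponent.one_sub_mul_le_card_mul (h : IsSpectrumProfile 1 ψ)
    (hψ : ∀ θ ∈ Set.Ioc (0 : ℝ) 1, 0 ≤ ψ θ) (hθ : θ ∈ Set.Ioo (0 : ℝ) 1) {s : ℝ} (hs0 : 0 ≤ s)
    (hs : IsMonotoneLowerExponent (coordinateSet ι (thinnedLine (codim ψ))) θ s) :
    (1 - θ) * s ≤ Fintype.card ι * ψ θ := by
  have hX := hasAssouadBound_coordinateSet (ι := ι) (thinnedLine (codim ψ))
  have hθ' : θ ∈ Set.Ioc (0 : ℝ) 1 := ⟨hθ.1, hθ.2.le⟩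
  set D := Fintype.card ι
  set u := (1 - ψ θ) / θ
  obtain ⟨C, hC, hlow⟩ := hs.exists_dyadic hX hθ.2.le (A := √D + 1)
    (le_add_of_nonneg_left (Real.sqrt_nonneg D))
  refine le_of_eventually_mul_two_rpow_le hC (K := 2 ^ (D * (u + 1))) ?_
  filter_upwards [Filter.eventually_ge_atTop ⌈1 / θ⌉₊] with b hb
  have hb1 : 1 ≤ θ * b := (div_le_iff₀' hθ.1).1 (Nat.ceil_le.1 hb)
  have hb0 : (0 : ℝ) < b := pos_of_mul_pos_right (one_pos.trans_le hb1) hθ.1.le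
  set a := ⌊θ * b⌋₊
  have ha : 0 < a := Nat.floor_pos.2 hb1
  have haθ : (a : ℝ) ≤ θ * b := Nat.floor_le (zero_le_one.trans hb1)
  have hab : a < b := Nat.cast_lt.1 (haθ.trans_lt (mul_lt_of_lt_one_left hb0 hθ.2))
  obtain ⟨x, hx, Q, hQcard, hQ, hcover⟩ := exists_finset_cover_thinnedLine h hψ ha hab
  have hprofile : ψ (a / b) * b ≤ ψ θ * b + u :=
    h.apply_floor_div_mul_le zero_le_one hθ' hb1
  have hup := closedBallCoveringNumber_le_ofReal_prod_card
    (x := (⟨WithLp.toLp 2 fun _ => x, fun _ => hx⟩ : coordinateSet ι (thinnedLine (codim ψ))))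
    (r := (√D + 1) * (1 / 2) ^ b) (δ := (1 / 2) ^ b) (Q := fun _ => Q) (by positivity)
    (by gcongr; linarith) (fun _ => hQ) fun _ => hcover
  have hle := (hlow _ a b ha haθ).trans hup
  rw [ENNReal.ofReal_le_ofReal_iff (by positivity), Finset.prod_const, Finset.card_univ] at hle
  calc C * 2 ^ ((1 - θ) * s * b) ≤ C * 2 ^ (s * (b - a)) := by
        refine mul_le_mul_of_nonneg_left (Real.rpow_le_rpow_of_exponent_le one_le_two ?_) hC.le
        linarith [mul_le_mul_of_nonneg_left haθ hs0]
    _ ≤ (Q.card : ℝ) ^ D := hle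
    _ ≤ (2 ^ (ψ θ * b + u + 1)) ^ D := by
        gcongr
        exact hQcard.trans (Real.rpow_le_rpow_of_exponent_le one_le_two (by linarith))
    _ = 2 ^ (D * (u + 1)) * 2 ^ (D * ψ θ * b) := by
        rw [← Real.rpow_mul_natCast zero_le_two, ← Real.rpow_add two_pos]
        ring_nf

theorem scaledMonotoneLowerSpectrum_coordinateSet_thinnedLine (h : IsSpectrumProfile 1 ψ)
    (hψ : ∀ θ ∈ Set.Ioc (0 : ℝ) 1, 0 ≤ ψ θ) (hθ : θ ∈ Set.Ioc (0 : ℝ) 1) :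
    scaledMonotoneLowerSpectrum (coordinateSet ι (thinnedLine (codim ψ))) θ =
      ENNReal.ofReal (Fintype.card ι * ψ θ) := by
  rcases hθ.2.eq_or_lt with rfl | hθ1
  · simp [scaledMonotoneLowerSpectrum_one, h.map_one]
  refine le_antisymm ?_ ?_
  · rw [scaledMonotoneLowerSpectrum_le_ofReal_iff hθ1 (mul_nonneg (Nat.cast_nonneg _) (hψ θ hθ))]
    exact fun s hs0 hs => hs.one_sub_mul_le_card_mul h hψ ⟨hθ.1, hθ1⟩ hs0
  · have hexp := isMonotoneLowerExponent_coordinateSet_thinnedLine (ι := ι) h hψ ⟨hθ.1, hθ1⟩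
    have hle := hexp.ofReal_le_scaledMonotoneLowerSpectrum hθ1
    rwa [mul_left_comm, one_sub_mul_one_sub_codim hθ1.ne] at hle

theorem exists_scaledMonotoneLowerSpectrum_eq_iff (ι : Type*) [Fintype ι] {φ : ℝ → ℝ}
    (hφ : ∀ θ ∈ Set.Ioc (0 : ℝ) 1, 0 ≤ φ θ) :
    (∃ F : Set (EuclideanSpace ℝ ι), F.Nonempty ∧
        ∀ θ ∈ Set.Ioc (0 : ℝ) 1, scaledMonotoneLowerSpectrum F θ = ENNReal.ofReal (φ θ)) ↔
      IsSpectrumProfile (Fintype.card ι) φ := by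
  constructor
  · rintro ⟨F, hF, hspectrum⟩
    have := hF.to_subtype
    have hX := hasAssouadBound_subtype F
    rw [finrank_euclideanSpace] at hX
    exact hX.isSpectrumProfile (Nat.cast_nonneg _) hφ hspectrum
  · intro h
    have hD : (0 : ℝ) ≤ Fintype.card ι := Nat.cast_nonneg _
    refine ⟨coordinateSet ι (thinnedLine (codim fun θ => φ θ / Fintype.card ι)),
      coordinateSet_nonempty ι (thinnedLine_nonempty _), fun θ hθ => ?_⟩
    rw [scaledMonotoneLowerSpectrum_coordinateSet_thinnedLine (h.div_const hD)
      (fun θ hθ => div_nonneg (hφ θ hθ) hD) hθ, mul_div_cancel_of_imp']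
    intro hzero
    have hle := h.le_mul_one_sub hθ
    rw [hzero, zero_mul] at hle
    exact hle.antisymm (hφ θ hθ)

end Realisation

theorem corollaryD (d : ℕ) (φ : ℝ → ℝ)
    (hφ : ∀ θ ∈ Set.Ioc (0 : ℝ) 1, φ θ ∈ Set.Icc (0 : ℝ) d) :
    ((∃ F : Set (EuclideanSpace ℝ (Fin d)), F.Nonempty ∧
        ∀ θ ∈ Set.Ioc (0 : ℝ) 1, scaledMonotoneLowerSpectrum F θ = ENNReal.ofReal (φ θ)) ↔
      (AntitoneOn (fun θ => φ θ / (1 - θ)) (Set.Ioo 0 1) ∧ φ 1 = 0 ∧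
        ∀ l ∈ Set.Ioc (0 : ℝ) 1, ∀ θ ∈ Set.Ioc (0 : ℝ) 1,
          φ (l * θ) - θ * φ l ≤ (1 - θ) * d)) ∧
    ((∃ F : Set (EuclideanSpace ℝ (Fin d)), F.Nonempty ∧
        ∀ θ ∈ Set.Ioc (0 : ℝ) 1, scaledMonotoneLowerSpectrum F θ = ENNReal.ofReal (φ θ)) ↔
      (∃ S : Set (ℝ × ℝ), S.Nonempty ∧
        (∀ p ∈ S, p.1 ∈ Set.Ioc (0 : ℝ) 1 ∧ p.2 ∈ Set.Icc (0 : ℝ) (d * (1 - p.1))) ∧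
        ∀ θ ∈ Set.Ioc (0 : ℝ) 1,
          IsGLB ((fun p : ℝ × ℝ => twoPieceAffine d p.1 p.2 θ) '' S) (φ θ))) := by
  have hφ0 : ∀ θ ∈ Set.Ioc (0 : ℝ) 1, 0 ≤ φ θ := fun θ hθ => (hφ θ hθ).1
  have hspectrum := exists_scaledMonotoneLowerSpectrum_eq_iff (Fin d) hφ0
  rw [Fintype.card_fin] at hspectrum
  exact ⟨hspectrum.trans isSpectrumProfile_iff,
    hspectrum.trans (isSpectrumProfile_iff_exists_isGLB d.cast_nonneg hφ0)⟩
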